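/- Let $\mathcal E$ be a Grothendieck topos, i.e. a category equivalent to the category of sheaves of sets on a small site, and let $\gamma:\mathcal E\to\mathbf{Set}$ be its (essentially unique) geometric morphism to the topos of sets. The topos $\mathcal E$ is called *connected* if $\gamma^*$ is full and faithful, *locally connected* if $\gamma^*$ has a left adjoint, and *atomic* if $\gamma^*$ is a logical functor (it preserves finite limits and power objects). It is called *coherent* (resp. *regular*) if it is equivalent to $\mathbf{Sh}(\mathcal C,J)$ for a small site $(\mathcal C,J)$ such that $\mathcal C$ has finite limits and every $J$-covering sieve contains a finite family of arrows (resp. a single arrow) generating a $J$-covering sieve. An object $A$ of $\mathcal E$ is an *atom* if its only subobjects are the identity and the zero subobject, and these are distinct; it is *indecomposable* if it is not initial and, whenever $A\cong X\sqcup Y$, one of $X,Y$ is initial. A family of arrows with codomain $A$ is *covering* if it is jointly epimorphic. $A$ is *compact* if every small covering family of $A$ contains a finite covering subfamily, and *supercompact* if every small covering family of $A$ contains an epimorphism. $A$ is *coherent* (resp. *regular*) if it is compact (resp. supercompact) and, for every arrow $f:B\to A$ with $B$ compact (resp. supercompact), the domain of the kernel pair of $f$ is compact (resp. supercompact). A *separating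 set* for $\mathcal E$ is a small set $\mathcal G$ of objects such that any two arrows $g,h:X\rightrightarrows Y$ with $g\circ a=h\circ a$ for all $G\in\mathcal G$ and all $a:G\to X$ are equal. Membership of the terminal object and closure under finite limits are understood up to isomorphism: $\mathcal G$ is closed under finite limits if every limit in $\mathcal E$ of a finite diagram of objects of $\mathcal G$ is isomorphic to an object of $\mathcal G$. **Theorem.** (i) $\mathcal E$ is locally connected if and only if it has a separating set of indecomposable objects. (ii) $\mathcal E$ is connected and locally connected if and only if it has a separating set of indecomposable objects containing the terminal object of $\mathcal E$. (iii) $\mathcal E$ is atomic if and only if it has a separating set of atoms. (iv) $\mathcal E$ is coherent (resp. regular) if and only if it has a separating set of coherent (resp. regular) objects which is closed in $\mathcal E$ under finite limits. -/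

import Mathlib

open CategoryTheory CategoryTheory.Limits

universe u v u' v'

namespace ToposTheory

/-! ### Grothendieck toposes and geometric morphisms -/

/-- A Grothendieck topos: a category equivalent to the category of sheaves of sets on a small
site. -/
class IsGrothendieckTopos (E : Type u) [Category.{v} E] : Prop where
  exists_site : ∃ (C : Type v) (_ : SmallCategory C) (J : GrothendieckTopology C),
    Nonempty (E ≌ Sheaf J (Type v))

/-- A geometric morphism `E ⟶ F`: an adjunction `inverseImage ⊣ directImage` whose left adjoint
preserves finite limits. -/
structure GeometricMorphism (E : Type u) [Category.{v} E] (F : Type u') [Category.{v'} F] where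
  directImage : E ⥤ F
  inverseImage : F ⥤ E
  adj : inverseImage ⊣ directImage
  preservesFiniteLimits : PreservesFiniteLimits inverseImage

/-! ### Properties of toposes

A Grothendieck topos has, up to isomorphism, exactly one geometric morphism to the topos `Type v`
of sets (its direct image is the global sections functor, its inverse image the constant sheaf
functor).  The properties below are properties of that morphism, so it does not matter whether it
is quantified existentially or universally. -/

/-- `E` is connected: the inverse image functor of its geometric morphism to sets is full and
faithful. -/
def IsConnectedTopos (E : Type u) [Category.{v} E] : Prop :=
  ∃ γ : GeometricMorphism E (Type v), γ.inverseImage.Full ∧ γ.inverseImage.Faithful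

/-- `E` is locally connected: the inverse image functor of its geometric morphism to sets has a
left adjoint.  (Over the base topos of sets a left adjoint is automatically an indexed one.) -/
def IsLocallyConnectedTopos (E : Type u) [Category.{v} E] : Prop :=
  ∃ γ : GeometricMorphism E (Type v), γ.inverseImage.IsRightAdjoint

/-- The relation `(p, q) : M ↣ P × A` exhibits `P` as a power object of `A`: every relation
`(r, s) : R ↣ B × A` is the pullback of `(p, q)` along `χ × 1 : B × A ⟶ P × A` for exactly one
`χ : B ⟶ P`.  That pullback is written, without choosing products, as a pullback `R` of `p`
along `χ` whose projection `t : R ⟶ M` satisfies `t ≫ q = s`. -/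
structure IsPowerObject {E : Type u} [Category.{v} E] {A P M : E} (p : M ⟶ P) (q : M ⟶ A) :
    Prop where
  jointlyMono : JointlyMono₂ p q
  existsUnique_classifying : ∀ ⦃B R : E⦄ (r : R ⟶ B) (s : R ⟶ A), JointlyMono₂ r s →
    ∃! χ : B ⟶ P, ∃ t : R ⟶ M, IsPullback t r p χ ∧ t ≫ q = s

/-- A logical functor: it preserves finite limits and power objects. -/
structure IsLogicalFunctor {E : Type u} [Category.{v} E] {F : Type u'} [Category.{v'} F]
    (L : E ⥤ F) : Prop where
  preservesFiniteLimits : PreservesFiniteLimits L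
  preservesPowerObjects : ∀ ⦃A P M : E⦄ (p : M ⟶ P) (q : M ⟶ A),
    IsPowerObject p q → IsPowerObject (L.map p) (L.map q)

/-- `E` is atomic: the inverse image functor of its geometric morphism to sets is logical. -/
def IsAtomicTopos (E : Type u) [Category.{v} E] : Prop :=
  ∃ γ : GeometricMorphism E (Type v), IsLogicalFunctor γ.inverseImage

/-- A coherent site: finite limits exist, and every covering sieve contains a finite (possibly
empty) family of arrows which generates a covering sieve. -/
structure IsCoherentSite {C : Type u} [Category.{v} C] (J : GrothendieckTopology C) : Prop where
  hasFiniteLimits : HasFiniteLimits C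
  finite_type : ∀ ⦃c : C⦄ (S : Sieve c), S ∈ J c →
    ∃ (n : ℕ) (X : Fin n → C) (f : ∀ i, X i ⟶ c),
      (∀ i, S (f i)) ∧ Sieve.generate (Presieve.ofArrows X f) ∈ J c

/-- A regular site: finite limits exist, and every covering sieve contains a single arrow which
generates a covering sieve. -/
structure IsRegularSite {C : Type u} [Category.{v} C] (J : GrothendieckTopology C) : Prop where
  hasFiniteLimits : HasFiniteLimits C
  single_arrow : ∀ ⦃c : C⦄ (S : Sieve c), S ∈ J c →
    ∃ (d : C) (f : d ⟶ c), S f ∧ Sieve.generate (Presieve.singleton f) ∈ J c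

/-- `E` is coherent: it is equivalent to the topos of sheaves on a small coherent site. -/
def IsCoherentTopos (E : Type u) [Category.{v} E] : Prop :=
  ∃ (C : Type v) (_ : SmallCategory C) (J : GrothendieckTopology C),
    IsCoherentSite J ∧ Nonempty (E ≌ Sheaf J (Type v))

/-- `E` is regular: it is equivalent to the topos of sheaves on a small regular site. -/
def IsRegularTopos (E : Type u) [Category.{v} E] : Prop :=
  ∃ (C : Type v) (_ : SmallCategory C) (J : GrothendieckTopology C),
    IsRegularSite J ∧ Nonempty (E ≌ Sheaf J (Type v))

/-! ### Properties of objects -/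

section Objects

variable {E : Type u} [Category.{v} E]

/-- `A` is an atom: its only subobjects are the identity and the zero subobject, and these two are
distinct. -/
def IsAtomObject (A : E) : Prop :=
  IsEmpty (IsInitial A) ∧
    ∀ ⦃B : E⦄ (m : B ⟶ A), Mono m → IsIso m ∨ Nonempty (IsInitial B)

/-- `A` is indecomposable: it has no non-trivial coproduct decomposition.  The initial object,
being the empty coproduct, is not indecomposable. -/
def IsIndecomposableObject (A : E) : Prop :=
  IsEmpty (IsInitial A) ∧
    ∀ ⦃X Y : E⦄ (i : X ⟶ A) (j : Y ⟶ A), Nonempty (IsColimit (BinaryCofan.mk i j)) →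
      Nonempty (IsInitial X) ∨ Nonempty (IsInitial Y)

/-- A family of arrows with common codomain is covering if it is jointly epimorphic. -/
def IsCoveringFamily {ι : Type*} {A : E} (X : ι → E) (f : ∀ i, X i ⟶ A) : Prop :=
  ∀ ⦃Z : E⦄ (g h : A ⟶ Z), (∀ i, f i ≫ g = f i ≫ h) → g = h

/-- `A` is compact: every small covering family contains a finite covering subfamily. -/
def IsCompactObject (A : E) : Prop :=
  ∀ ⦃ι : Type v⦄ (X : ι → E) (f : ∀ i, X i ⟶ A), IsCoveringFamily X f →
    ∃ s : Finset ι, IsCoveringFamily (fun i : s => X i) (fun i : s => f i)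

/-- `A` is coherent: it is compact, and for every `f : B ⟶ A` with `B` compact the domain of the
kernel pair of `f` is compact. -/
def IsCoherentObject (A : E) : Prop :=
  IsCompactObject A ∧ ∀ ⦃B K : E⦄ (f : B ⟶ A) (p q : K ⟶ B),
    IsCompactObject B → IsKernelPair f p q → IsCompactObject K

/-- `A` is supercompact: every small covering family contains a cover, that is, an epimorphism. -/
def IsSupercompactObject (A : E) : Prop :=
  ∀ ⦃ι : Type v⦄ (X : ι → E) (f : ∀ i, X i ⟶ A), IsCoveringFamily X f → ∃ i, Epi (f i)

/-- `A` is regular: it is supercompact, and for every `f : B ⟶ A` with `B` supercompact the domain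
of the kernel pair of `f` is supercompact. -/
def IsRegularObject (A : E) : Prop :=
  IsSupercompactObject A ∧ ∀ ⦃B K : E⦄ (f : B ⟶ A) (p q : K ⟶ B),
    IsSupercompactObject B → IsKernelPair f p q → IsSupercompactObject K

/-! ### Sets of objects -/

/-- A separating set: a small set `P` of objects such that two parallel arrows agree as soon as
they agree after composition with all arrows from objects of `P`. -/
def IsSeparatingSet (P : ObjectProperty E) : Prop :=
  ObjectProperty.Small.{v} P ∧ P.IsSeparating

/-- `P` contains the terminal object (objects being considered up to isomorphism). -/
def ContainsTerminal (P : ObjectProperty E) : Prop :=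
  ∃ T : E, P T ∧ Nonempty (IsTerminal T)

/-- `P` is closed under finite limits: each limit of a finite diagram of objects of `P` is
isomorphic to an object of `P`. -/
def IsClosedUnderFiniteLimits (P : ObjectProperty E) : Prop :=
  ∀ (K : Type) [SmallCategory K] [FinCategory K] (F : K ⥤ E) (c : Cone F),
    (∀ k, P (F.obj k)) → IsLimit c → ∃ Y : E, P Y ∧ Nonempty (c.pt ≅ Y)

end Objects

end ToposTheory

/-!
# Characterizations of toposes by separating sets

Throughout, a topos `E` carries the topology whose covering sieves are the jointly epimorphic ones.
For a presentation `e : E ≌ Sheaf J (Type v)`, a sieve on an object is jointly epimorphic exactly if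
its sections are locally surjective (`JointlyEpi.mem_of_section`, `JointlyEpi.of_sections`).  Hence
these sieves are stable under pullback, representable presheaves are sheaves for them, and the
sheafified representables `generator e` embed the site as a dense subsite.  By the comparison lemma,
`E` is the topos of sheaves on each small separating family of its objects
(`nonempty_equivalence_sheaf`), and arrows of `E` may be defined and compared on such a family.

For a geometric morphism `γ` to sets, an arrow `A ⟶ γ^* S` is a decomposition of `A` into disjoint
fibers indexed by `S`.  If `A` is indecomposable, exactly one fiber is not initial, so that
`s ↦ γ.constHom A s` is a bijection from `S` to the arrows `A ⟶ γ^* S`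
(`GeometricMorphism.bijective_constHom`).  On a separating family of indecomposables, `γ^*` is thus
the constant presheaf functor, and its left adjoint is the colimit functor.  Conversely, if `L` is
left adjoint to `γ^*`, the fibers of the unit `X ⟶ γ^* (L X)` are indecomposable, and they cover
`X`.  An indecomposable terminal object means that `γ^*` is full and faithful.

If `γ^*` is logical, classify the relation from `X` to `γ^* A` formed by all subobjects
`U a`, `a : A`, of `X`: on a fiber of the classifying arrow `X ⟶ γ^* (Set A)` each `U a` is
everything or nothing, so that the fiber is an atom or initial (`exists_cover_by_atoms`).  Conversely, on an
atom a relation to `γ^* A` is a subset of `A`; if the atoms separate, this says that `γ^*` preserves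
power objects (`isPowerObject_inverseImage`).

The coherent and the regular case are one argument, with finite or one-element index types for the
covering subfamilies.  In the topos of a site with finite limits and such covers, the generators are
coherent (`isCoherentFor_generator`).  Coherent objects are closed under pullbacks
(`IsCoherentFor.of_isPullback`): the fibre product of two compact objects over `B ×[A] B'` is the
equalizer of two arrows from a compact object to `B'`, hence is covered by equalizers of arrows from
generators to `B'`, which are compact (`isCompactFor_equalizer`).  The closure of the generators
under pullbacks is the required separating set.  Conversely, a separating set of compact objects
closed under finite limits is itself a site of the required kind.
-/

namespace ToposTheory

open Opposite

/-! ### Sieves of a topos and sieves of a site -/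

/-- A sieve is jointly epimorphic if two arrows out of its vertex agree as soon as they agree
after composition with each arrow of the sieve. -/
def JointlyEpi {E : Type u} [Category.{v} E] {A : E} (S : Sieve A) : Prop :=
  ∀ ⦃Z : E⦄ (g h : A ⟶ Z), (∀ ⦃Y : E⦄ (f : Y ⟶ A), S f → f ≫ g = f ≫ h) → g = h

section Model

variable {E : Type u} [Category.{v} E] {C : Type v} [SmallCategory C]
  {J : GrothendieckTopology C} (e : E ≌ Sheaf J (Type v))

/-- The object of `E` represented by `c : C`: the sheafification of the presheaf represented
by `c`, transported along `e`. -/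
noncomputable def generator : C ⥤ E := yoneda ⋙ presheafToSheaf J (Type v) ⋙ e.inverse

/-- The functor which sends an object of `E` to its presheaf of sections. -/
def sectionsFunctor : E ⥤ Cᵒᵖ ⥤ Type v := e.functor ⋙ sheafToPresheaf J (Type v)

instance : (sectionsFunctor e).Full := by unfold sectionsFunctor; infer_instance

instance : (sectionsFunctor e).Faithful := by unfold sectionsFunctor; infer_instance

lemma sectionsFunctor_isSheaf (X : E) : Presieve.IsSheaf J ((sectionsFunctor e).obj X) :=
  (isSheaf_iff_isSheaf_of_type _ _).1 (e.functor.obj X).property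

/-- Sheafification, followed by `e`, is left adjoint to the functor of sections. -/
noncomputable def sectionsAdj :
    presheafToSheaf J (Type v) ⋙ e.inverse ⊣ sectionsFunctor e :=
  (sheafificationAdjunction J (Type v)).comp e.symm.toAdjunction

/-- Sections over `c` are arrows out of the object represented by `c`. -/
noncomputable def sectionsEquiv (c : C) (X : E) :
    ((generator e).obj c ⟶ X) ≃ ((sectionsFunctor e).obj X).obj (op c) :=
  ((sectionsAdj e).homEquiv (yoneda.obj c) X).trans yonedaEquiv

lemma sectionsEquiv_comp {c : C} {X Y : E} (x : (generator e).obj c ⟶ X) (f : X ⟶ Y) :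
    sectionsEquiv e c Y (x ≫ f) =
      ((sectionsFunctor e).map f).app (op c) (sectionsEquiv e c X x) := by
  have := (sectionsAdj e).homEquiv_naturality_right (X := yoneda.obj c) x f
  change yonedaEquiv ((sectionsAdj e).homEquiv _ _ (x ≫ f)) = _
  rw [this]
  rfl

lemma sectionsEquiv_map {c d : C} (k : d ⟶ c) {X : E} (x : (generator e).obj c ⟶ X) :
    sectionsEquiv e d X ((generator e).map k ≫ x) =
      ((sectionsFunctor e).obj X).map k.op (sectionsEquiv e c X x) := by
  have := (sectionsAdj e).homEquiv_naturality_left (yoneda.map k) x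
  change yonedaEquiv ((sectionsAdj e).homEquiv _ _
    ((presheafToSheaf J (Type v) ⋙ e.inverse).map (yoneda.map k) ≫ x)) = _
  rw [this]
  exact (yonedaEquiv_naturality _ _).symm

/-- The presheaf of arrows out of the generators is the presheaf of sections. -/
noncomputable def restrictedYonedaIso (X : E) :
    (generator e).op ⋙ yoneda.obj X ≅ (sectionsFunctor e).obj X :=
  NatIso.ofComponents (fun c => (sectionsEquiv e c.unop X).toIso) fun {c d} k => by
    ext x
    exact sectionsEquiv_map e k.unop x

lemma restrictedYoneda_isSheaf (X : E) :
    Presieve.IsSheaf J ((generator e).op ⋙ yoneda.obj X) :=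
  Presieve.isSheaf_iso J (restrictedYonedaIso e X).symm (sectionsFunctor_isSheaf e X)

/-- The generators are dense: a natural family of maps between the sets of arrows out of the
generators comes from an arrow. -/
lemma exists_hom_of_natural {X Y : E}
    (φ : ∀ c, ((generator e).obj c ⟶ X) → ((generator e).obj c ⟶ Y))
    (hφ : ∀ ⦃c d⦄ (k : d ⟶ c) x, φ d ((generator e).map k ≫ x) = (generator e).map k ≫ φ c x) :
    ∃ f : X ⟶ Y, ∀ c x, φ c x = x ≫ f := by
  let τ : (generator e).op ⋙ yoneda.obj X ⟶ (generator e).op ⋙ yoneda.obj Y :=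
    { app := fun c => ↾(φ c.unop)
      naturality := fun c d k => by
        ext x
        exact hφ k.unop x }
  obtain ⟨f, hf⟩ := (sectionsFunctor e).map_surjective
    ((restrictedYonedaIso e X).inv ≫ τ ≫ (restrictedYonedaIso e Y).hom)
  refine ⟨f, fun c x => ?_⟩
  apply (sectionsEquiv e c Y).injective
  rw [sectionsEquiv_comp, hf]
  have h1 : (restrictedYonedaIso e X).inv.app (op c) (sectionsEquiv e c X x) = x :=
    (sectionsEquiv e c X).symm_apply_apply x
  simp only [NatTrans.comp_app, comp_apply, h1]
  rfl

lemma generator_hom_ext {X Y : E} {f g : X ⟶ Y}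
    (h : ∀ c (x : (generator e).obj c ⟶ X), x ≫ f = x ≫ g) : f = g := by
  apply (sectionsFunctor e).map_injective
  ext c x
  obtain ⟨y, rfl⟩ := (sectionsEquiv e c.unop X).surjective x
  have := congrArg (sectionsEquiv e c.unop Y) (h c.unop y)
  rwa [sectionsEquiv_comp, sectionsEquiv_comp] at this

lemma hom_ext_of_cover {c : C} {T : Sieve c} (hT : T ∈ J c) {X : E}
    {x y : (generator e).obj c ⟶ X}
    (h : ∀ ⦃d⦄ (k : d ⟶ c), T k → (generator e).map k ≫ x = (generator e).map k ≫ y) : x = y :=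
  (restrictedYoneda_isSheaf e X T hT).isSeparatedFor.ext (t₁ := x) (t₂ := y) fun _ k hk => h k hk

/-- The comparison of a representable presheaf with the sections of the object it represents. -/
noncomputable def sectionsUnit (d : C) :
    yoneda.obj d ⟶ (sectionsFunctor e).obj ((generator e).obj d) :=
  (sectionsAdj e).unit.app (yoneda.obj d)

lemma sectionsUnit_eq (d : C) : sectionsUnit e d = toSheafify J (yoneda.obj d) ≫
    (sheafToPresheaf J (Type v)).map
      (e.symm.unit.app ((presheafToSheaf J (Type v)).obj (yoneda.obj d))) :=
  Adjunction.comp_unit_app _ _ _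

lemma isLocallySurjective_sectionsUnit (d : C) :
    Presheaf.IsLocallySurjective J (sectionsUnit e d) := by
  have h {P Q R : Cᵒᵖ ⥤ Type v} (f : P ⟶ Q) (g : Q ⟶ R) (hf : Presheaf.IsLocallySurjective J f)
      (hg : IsIso g) : Presheaf.IsLocallySurjective J (f ≫ g) := inferInstance
  rw [sectionsUnit_eq]
  exact h _ _ inferInstance (Functor.map_isIso _ (e.symm.unitIso.hom.app _))

lemma isLocallyInjective_sectionsUnit (d : C) :
    Presheaf.IsLocallyInjective J (sectionsUnit e d) := by
  have h {P Q R : Cᵒᵖ ⥤ Type v} (f : P ⟶ Q) (g : Q ⟶ R) (hf : Presheaf.IsLocallyInjective J f)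
      (hg : IsIso g) : Presheaf.IsLocallyInjective J (f ≫ g) := inferInstance
  rw [sectionsUnit_eq]
  exact h _ _ inferInstance (Functor.map_isIso _ (e.symm.unitIso.hom.app _))

lemma sectionsEquiv_generator_map {c d : C} (l : c ⟶ d) :
    sectionsEquiv e c _ ((generator e).map l) = (sectionsUnit e d).app (op c) l := by
  have h : (sectionsAdj e).homEquiv _ _
      ((presheafToSheaf J (Type v) ⋙ e.inverse).map (yoneda.map l)) =
      yoneda.map l ≫ sectionsUnit e d :=
    ((sectionsAdj e).homEquiv_unit ..).trans
      ((sectionsAdj e).unit.naturality (yoneda.map l)).symm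
  change yonedaEquiv ((sectionsAdj e).homEquiv _ _ _) = _
  refine (congrArg yonedaEquiv h).trans ?_
  exact congrArg ((sectionsUnit e d).app (op c)) (Category.id_comp l)

/-- Arrows between the objects represented by `c` and `d` come locally from the site. -/
lemma imageSieve_generator_mem {c d : C} (f : (generator e).obj c ⟶ (generator e).obj d) :
    (generator e).imageSieve f ∈ J c := by
  have := isLocallySurjective_sectionsUnit e d
  refine J.superset_covering ?_
    (Presheaf.imageSieve_mem J (sectionsUnit e d) (U := op c) (sectionsEquiv e c _ f))
  rintro b k ⟨l, hl⟩
  refine ⟨l, (sectionsEquiv e b _).injective ?_⟩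
  rw [sectionsEquiv_map, sectionsEquiv_generator_map]
  exact hl

/-- Arrows of the site which are identified in the topos agree locally. -/
lemma equalizer_mem_of_generator_map_eq {c d : C} {k l : c ⟶ d}
    (h : (generator e).map k = (generator e).map l) : Sieve.equalizer k l ∈ J c := by
  have := isLocallyInjective_sectionsUnit e d
  exact Presheaf.equalizerSieve_mem J (sectionsUnit e d) (X := op c) k l (by
    rw [← sectionsEquiv_generator_map, ← sectionsEquiv_generator_map, h])

/-- The key link between the category `E` and its site: a jointly epimorphic sieve is locally
surjective on sections. -/
lemma JointlyEpi.mem_of_section {X : E} {S : Sieve X} (hS : JointlyEpi S) {c : C}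
    (x : (generator e).obj c ⟶ X) : (S.pullback x).functorPullback (generator e) ∈ J c := by
  -- The sections in `S` form a subpresheaf.  Its closure is a subsheaf through which all arrows of
  -- `S` factor, so that the inclusion of this subsheaf is an epimorphism of sheaves.
  let G : Subfunctor ((sectionsFunctor e).obj X) :=
    { obj := fun c => {s | S ((sectionsEquiv e c.unop X).symm s)}
      map := fun {c d} k s hs => by
        obtain ⟨y, rfl⟩ := (sectionsEquiv e c.unop X).surjective s
        change S ((sectionsEquiv e d.unop X).symm (((sectionsFunctor e).obj X).map k.unop.op _))
        rw [← sectionsEquiv_map, Equiv.symm_apply_apply]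
        replace hs : S _ := hs
        rw [Equiv.symm_apply_apply] at hs
        exact S.downward_closed hs _ }
  let I : Sheaf J (Type v) := ⟨(G.sheafify J).toFunctor, (isSheaf_iff_isSheaf_of_type _ _).2
    (G.sheafify_isSheaf (sectionsFunctor_isSheaf e X))⟩
  let ι : I ⟶ e.functor.obj X := ⟨(G.sheafify J).ι⟩
  have hι : Epi ι := by
    refine ⟨fun {Z} u w huw => ?_⟩
    apply (e.toAdjunction.homEquiv _ _).injective
    refine hS _ _ fun Y f hf => ?_
    rw [← Adjunction.homEquiv_naturality_left, ← Adjunction.homEquiv_naturality_left]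
    congr 1
    let t : e.functor.obj Y ⟶ I := ⟨Subfunctor.lift ((sectionsFunctor e).map f) (by
      refine le_trans ?_ (G.le_sheafify J)
      rintro ⟨d⟩ _ ⟨z, rfl⟩
      obtain ⟨y, rfl⟩ := (sectionsEquiv e d Y).surjective z
      change S ((sectionsEquiv e d X).symm _)
      rw [← sectionsEquiv_comp, Equiv.symm_apply_apply]
      exact S.downward_closed hf y)⟩
    have ht : e.functor.map f = t ≫ ι := rfl
    rw [ht, Category.assoc, Category.assoc, huw]
  have hsurj : Presheaf.IsLocallySurjective J ι.hom := (Sheaf.isLocallySurjective_iff_epi ι).2 hι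
  refine J.transitive (Presheaf.imageSieve_mem J ι.hom (U := op c) (sectionsEquiv e c X x)) _ ?_
  rintro d k ⟨⟨t, ht⟩, hl⟩
  refine J.superset_covering ?_ ht
  intro b l hb
  replace hl : t = _ := hl
  subst hl
  change S ((sectionsEquiv e b X).symm (((sectionsFunctor e).obj X).map l.op
    (((sectionsFunctor e).obj X).map k.op (sectionsEquiv e c X x)))) at hb
  rw [← sectionsEquiv_map, ← sectionsEquiv_map, Equiv.symm_apply_apply] at hb
  change S ((generator e).map (l ≫ k) ≫ x)
  rwa [Functor.map_comp, Category.assoc]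

/-- Conversely, local surjectivity on sections is enough. -/
lemma JointlyEpi.of_sections {X : E} {S : Sieve X}
    (h : ∀ c (x : (generator e).obj c ⟶ X), (S.pullback x).functorPullback (generator e) ∈ J c) :
    JointlyEpi S := fun Z f g hfg =>
  generator_hom_ext e fun c x => hom_ext_of_cover e (h c x) fun d k hk => by
    simpa using hfg _ hk

include e in
lemma JointlyEpi.pullback_of_equivalence {X Y : E} {S : Sieve X} (hS : JointlyEpi S) (g : Y ⟶ X) :
    JointlyEpi (S.pullback g) :=
  .of_sections e fun c x => by
    rw [← Sieve.pullback_comp]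
    exact hS.mem_of_section e (x ≫ g)

include e in
lemma JointlyEpi.isSheafFor_of_equivalence {X : E} {S : Sieve X} (hS : JointlyEpi S) (Y : E) :
    Presieve.IsSheafFor (yoneda.obj Y) S.arrows := by
  intro s hs
  -- Glue along each section `x` of `X` first; the results are natural in `x`.
  let T {c : C} (x : (generator e).obj c ⟶ X) : Sieve c :=
    (S.pullback x).functorPullback (generator e)
  have hT {c : C} (x : (generator e).obj c ⟶ X) := restrictedYoneda_isSheaf e Y _
    (hS.mem_of_section e x)
  let r {c : C} (x : (generator e).obj c ⟶ X) :
      Presieve.FamilyOfElements ((generator e).op ⋙ yoneda.obj Y) (T x).arrows :=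
    fun d k hk => s ((generator e).map k ≫ x) hk
  have hr {c : C} (x : (generator e).obj c ⟶ X) : (r x).Compatible := by
    intro d₁ d₂ d g₁ g₂ k₁ k₂ h₁ h₂ h
    refine hs _ _ _ _ ?_
    change (generator e).map g₁ ≫ _ = (generator e).map g₂ ≫ _
    rw [← Functor.map_comp_assoc, h, Functor.map_comp_assoc]
  choose φ hφ hφ' using fun (c : C) (x : (generator e).obj c ⟶ X) => hT x (r x) (hr x)
  obtain ⟨f, hf⟩ := exists_hom_of_natural e (X := X) (Y := Y) φ (by
    intro c d k x
    refine (hφ' d _ _ ?_).symm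
    intro b l hl
    have hl' : S ((generator e).map (l ≫ k) ≫ x) := by
      rw [Functor.map_comp, Category.assoc]; exact hl
    have := hφ c x (l ≫ k) hl'
    change (generator e).map (l ≫ k) ≫ φ c x = s _ hl' at this
    change (generator e).map l ≫ (generator e).map k ≫ φ c x = s _ _
    rw [← Functor.map_comp_assoc, this]
    congr 1
    rw [Functor.map_comp, Category.assoc])
  have key : ∀ ⦃Z : E⦄ (g : Z ⟶ X) (hg : S g), g ≫ f = s g hg := by
    intro Z g hg
    refine generator_hom_ext e fun c x => ?_
    rw [← Category.assoc, ← hf]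
    have hx : S (x ≫ g) := S.downward_closed hg x
    have hx' : S ((generator e).map (𝟙 c) ≫ x ≫ g) := S.downward_closed hx _
    have h1 : (generator e).map (𝟙 c) ≫ φ c (x ≫ g) = s _ hx' := hφ c (x ≫ g) (𝟙 c) hx'
    have h2 : (generator e).map (𝟙 c) ≫ x ≫ s g hg = 𝟙 _ ≫ s _ hx' := by
      rw [← Category.assoc]
      exact hs ((generator e).map (𝟙 c) ≫ x) (𝟙 _) hg hx' (by simp)
    simpa using h1.trans ((Category.id_comp _).symm.trans h2.symm)
  exact ⟨f, key, fun f' hf' => hS _ _ fun Z g hg => (hf' g hg).trans (key g hg).symm⟩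

/-- A sieve of the site is covering exactly if its image in the topos is jointly epimorphic. -/
lemma functorPushforward_generator_jointlyEpi_iff {c : C} {S : Sieve c} :
    JointlyEpi (S.functorPushforward (generator e)) ↔ S ∈ J c := by
  constructor
  · intro h
    refine J.transitive (h.mem_of_section e (𝟙 _)) _ ?_
    rintro d k ⟨c', s, u, hs, hk⟩
    rw [Category.comp_id] at hk
    refine J.transitive (imageSieve_generator_mem e u) _ ?_
    rintro d' k' ⟨l, hl⟩
    have : (generator e).map (k' ≫ k) = (generator e).map (l ≫ s) := by
      rw [Functor.map_comp, Functor.map_comp, hl, hk, Category.assoc]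
    refine J.superset_covering ?_ (equalizer_mem_of_generator_map_eq e this)
    intro b m hm
    change m ≫ k' ≫ k = m ≫ l ≫ s at hm
    change S ((m ≫ k') ≫ k)
    rw [Category.assoc, hm, ← Category.assoc]
    exact S.downward_closed hs _
  · intro h Z f g hfg
    refine hom_ext_of_cover e h fun d k hk => hfg _ ?_
    exact ⟨d, k, 𝟙 _, hk, by simp⟩

end Model

/-! ### The topology of jointly epimorphic sieves -/

lemma isCoveringFamily_iff_jointlyEpi {E : Type u} [Category.{v} E] {ι : Type*} {A : E}
    {X : ι → E} {f : ∀ i, X i ⟶ A} :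
    IsCoveringFamily X f ↔ JointlyEpi (Sieve.ofArrows X f) := by
  refine ⟨fun H Z g h hgh => H g h fun i => hgh _ (Sieve.ofArrows_mk _ _ i),
    fun H Z g h hgh => H g h ?_⟩
  rintro Y _ ⟨_, a, _, ⟨i⟩, rfl⟩
  rw [Category.assoc, hgh, Category.assoc]

section Topos

variable {E : Type u} [Category.{v} E] [IsGrothendieckTopos E]

lemma JointlyEpi.pullback {X Y : E} {S : Sieve X} (hS : JointlyEpi S) (g : Y ⟶ X) :
    JointlyEpi (S.pullback g) := by
  obtain ⟨C, _, J, ⟨e⟩⟩ := IsGrothendieckTopos.exists_site (E := E)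
  exact hS.pullback_of_equivalence e g

lemma JointlyEpi.isSheafFor {X : E} {S : Sieve X} (hS : JointlyEpi S) (Y : E) :
    Presieve.IsSheafFor (yoneda.obj Y) S.arrows := by
  obtain ⟨C, _, J, ⟨e⟩⟩ := IsGrothendieckTopos.exists_site (E := E)
  exact hS.isSheafFor_of_equivalence e Y

variable (E) in
/-- The topology on a topos whose covering sieves are the jointly epimorphic ones.  It is the
canonical topology. -/
def epiTopology : GrothendieckTopology E where
  sieves A := {S | JointlyEpi S}
  top_mem' A Z g h hgh := by simpa using hgh (𝟙 A) trivial
  pullback_stable' A B S f hS := JointlyEpi.pullback hS f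
  transitive' A S hS R hR Z g h hgh := by
    refine hS g h fun Y f hf => hR hf _ _ fun W k hk => ?_
    simpa using hgh (k ≫ f) hk

lemma hom_ext_of_mem {A : E} {S : Sieve A} (hS : S ∈ epiTopology E A) {Z : E} {g h : A ⟶ Z}
    (hgh : ∀ ⦃Y⦄ (f : Y ⟶ A), S f → f ≫ g = f ≫ h) : g = h :=
  hS g h hgh

lemma isSheaf_yoneda (Y : E) : Presieve.IsSheaf (epiTopology E) (yoneda.obj Y) :=
  fun _ _ hS => JointlyEpi.isSheafFor hS Y

lemma isCoveringFamily_iff {ι : Type*} {A : E} {X : ι → E} {f : ∀ i, X i ⟶ A} :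
    IsCoveringFamily X f ↔ Sieve.ofArrows X f ∈ epiTopology E A :=
  isCoveringFamily_iff_jointlyEpi

/-- A family of arrows is covering as soon as the arrows which factor through a member of the
family include a covering sieve. -/
lemma isCoveringFamily_of_mem {ι : Type*} {A : E} {X : ι → E} {f : ∀ i, X i ⟶ A} {S : Sieve A}
    (hS : S ∈ epiTopology E A)
    (h : ∀ ⦃W⦄ (k : W ⟶ A), S k → ∃ i, ∃ a : W ⟶ X i, a ≫ f i = k) : IsCoveringFamily X f := by
  refine isCoveringFamily_iff.2 ((epiTopology E).superset_covering (fun W k hk => ?_) hS)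
  obtain ⟨i, a, rfl⟩ := h k hk
  exact Sieve.downward_closed _ (Sieve.ofArrows_mk _ _ i) _

/-- Arrows defined on the members of a covering family glue. -/
lemma exists_glue {ι : Type*} {A : E} {X : ι → E} {f : ∀ i, X i ⟶ A} (hf : IsCoveringFamily X f)
    {T : E} (g : ∀ i, X i ⟶ T)
    (hg : ∀ ⦃i j W⦄ (a : W ⟶ X i) (b : W ⟶ X j), a ≫ f i = b ≫ f j → a ≫ g i = b ≫ g j) :
    ∃ l : A ⟶ T, ∀ i, f i ≫ l = g i := by
  have h := isSheaf_yoneda T _ (isCoveringFamily_iff.1 hf)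
  rw [Sieve.ofArrows, ← Presieve.isSheafFor_iff_generate, Presieve.isSheafFor_arrows_iff] at h
  obtain ⟨l, hl, -⟩ := h g fun i j W a b hab => hg a b hab
  exact ⟨l, hl⟩

/-- Factorization through a monomorphism is a local property. -/
lemma exists_lift_of_mem {A B W : E} (m : B ⟶ A) [Mono m] (g : W ⟶ A) {S : Sieve W}
    (hS : S ∈ epiTopology E W) (h : ∀ ⦃V⦄ (k : V ⟶ W), S k → ∃ l, l ≫ m = k ≫ g) :
    ∃ l, l ≫ m = g := by
  choose l hl using h
  obtain ⟨t, ht, -⟩ := isSheaf_yoneda B S hS l fun V₁ V₂ V a b k₁ k₂ h₁ h₂ hab => by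
    change a ≫ l k₁ h₁ = b ≫ l k₂ h₂
    rw [← cancel_mono m, Category.assoc, Category.assoc, hl, hl, ← Category.assoc, hab,
      Category.assoc]
  refine ⟨t, hom_ext_of_mem hS fun V k hk => ?_⟩
  have : k ≫ t = l k hk := ht k hk
  rw [← Category.assoc, this, hl]

lemma isIso_of_mono_of_mem {A B : E} (m : B ⟶ A) [Mono m] {S : Sieve A}
    (hS : S ∈ epiTopology E A) (h : ∀ ⦃V⦄ (k : V ⟶ A), S k → ∃ l, l ≫ m = k) : IsIso m := by
  obtain ⟨l, hl⟩ := exists_lift_of_mem m (𝟙 A) hS fun V k hk => by simpa using h k hk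
  exact ⟨l, by rw [← cancel_mono m, Category.assoc, hl]; simp, hl⟩

/-! ### Initial objects -/

/-- An object is initial exactly if it is covered by the empty sieve. -/
lemma nonempty_isInitial_iff {A : E} : Nonempty (IsInitial A) ↔ ⊥ ∈ epiTopology E A := by
  constructor
  · rintro ⟨hA⟩ Z g h -
    exact hA.hom_ext g h
  · intro h
    have H (Y : E) := isSheaf_yoneda Y _ h (fun _ _ h => h.elim) (fun _ _ _ _ _ _ _ h => h.elim)
    choose t _ _ using H
    exact ⟨IsInitial.ofUniqueHom t fun Y m => hom_ext_of_mem h fun _ _ h => h.elim⟩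

/-- Initial objects are strict. -/
lemma bot_mem_of_hom {A B : E} (f : B ⟶ A) (h : ⊥ ∈ epiTopology E A) : ⊥ ∈ epiTopology E B := by
  simpa using (epiTopology E).pullback_stable f h

lemma bot_mem_of_cover {A : E} {S : Sieve A} (hS : S ∈ epiTopology E A)
    (h : ∀ ⦃B⦄ (f : B ⟶ A), S f → ⊥ ∈ epiTopology E B) : ⊥ ∈ epiTopology E A :=
  (epiTopology E).transitive hS _ fun B f hf => by simpa using h f hf

lemma hom_eq_of_bot_mem {A B : E} (h : ⊥ ∈ epiTopology E A) (f g : A ⟶ B) : f = g :=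
  hom_ext_of_mem h fun _ _ h => h.elim

/-- Two disjoint subobjects which cover an object exhibit it as their coproduct. -/
lemma nonempty_isColimit_binaryCofan {A X Y : E} (i : X ⟶ A) (j : Y ⟶ A) [Mono i] [Mono j]
    {S : Sieve A} (hS : S ∈ epiTopology E A)
    (h : ∀ ⦃W⦄ (k : W ⟶ A), S k → (∃ a, a ≫ i = k) ∨ ∃ b, b ≫ j = k)
    (hd : ∀ ⦃W⦄ (a : W ⟶ X) (b : W ⟶ Y), a ≫ i = b ≫ j → ⊥ ∈ epiTopology E W) :
    Nonempty (IsColimit (BinaryCofan.mk i j)) := by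
  let X' : Bool → E := fun t => Bool.rec X Y t
  let f : ∀ t, X' t ⟶ A := fun t => Bool.rec i j t
  have hf : IsCoveringFamily X' f := isCoveringFamily_of_mem hS fun W k hk => by
    obtain h | h := h k hk
    exacts [⟨false, h⟩, ⟨true, h⟩]
  have H {T : E} (p : X ⟶ T) (q : Y ⟶ T) : ∃ l : A ⟶ T, i ≫ l = p ∧ j ≫ l = q := by
    obtain ⟨l, hl⟩ := exists_glue hf (fun t => Bool.rec p q t : ∀ t, X' t ⟶ T) (by
      rintro (_ | _) (_ | _) W a b hab
      · rw [(cancel_mono i).1 hab]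
      · exact hom_eq_of_bot_mem (hd a b hab) _ _
      · exact hom_eq_of_bot_mem (hd b a hab.symm) _ _
      · rw [(cancel_mono j).1 hab])
    exact ⟨l, hl false, hl true⟩
  choose l hl hl' using @H
  refine ⟨BinaryCofan.IsColimit.mk _ l hl hl' fun {T} p q m h₁ h₂ => hf _ _ ?_⟩
  rintro (_ | _)
  · exact h₁.trans (hl p q).symm
  · exact h₂.trans (hl' p q).symm

/-! ### Sites of definition -/

section Generator

variable {C : Type v} [SmallCategory C] {J : GrothendieckTopology C} (e : E ≌ Sheaf J (Type v))

instance generator_isCoverDense : (generator e).IsCoverDense (epiTopology E) where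
  is_cover _ _ _ _ h := generator_hom_ext e fun _ x => h x (Presieve.in_coverByImage _ x)

instance generator_isDenseSubsite : (generator e).IsDenseSubsite J (epiTopology E) where
  isLocallyFull' := ⟨fun f => (functorPushforward_generator_jointlyEpi_iff e).2
    (imageSieve_generator_mem e f)⟩
  isLocallyFaithful' := ⟨fun _ _ h => (functorPushforward_generator_jointlyEpi_iff e).2
    (equalizer_mem_of_generator_map_eq e h)⟩
  functorPushforward_mem_iff := functorPushforward_generator_jointlyEpi_iff e

end Generator

section Separating

variable {I : Type v} {o : I → E}

lemma isCoverDense_inducedFunctor (ho : (ObjectProperty.ofObj o).IsSeparating) :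
    (inducedFunctor o).IsCoverDense (epiTopology E) where
  is_cover X Z f g h := by
    refine ho _ _ ?_
    rintro _ ⟨i⟩ x
    exact h x (Presieve.in_coverByImage (inducedFunctor o) (Y := i) x)

/-- The comparison lemma: a topos is the category of sheaves on any small separating family of
its objects. -/
lemma nonempty_equivalence_sheaf [(inducedFunctor o).IsCoverDense (epiTopology E)] :
    Nonempty (E ≌ Sheaf ((inducedFunctor o).inducedTopology (epiTopology E)) (Type v)) := by
  obtain ⟨C, _, J, ⟨e⟩⟩ := IsGrothendieckTopos.exists_site (E := E)
  exact ⟨e.trans ((Functor.IsDenseSubsite.sheafEquiv J (epiTopology E) (generator e) (Type v)).trans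
    (Functor.IsDenseSubsite.sheafEquiv _ (epiTopology E) (inducedFunctor o) (Type v)).symm)⟩

end Separating

end Topos

/-! ### Constant arrows and indecomposable objects -/

section Restricted

variable {E : Type u} [Category.{v} E] {I : Type v} (o : I → E)

/-- The functor which sends an object `X` of `E` to the presheaf `i ↦ (o i ⟶ X)` on the full
subcategory of `E` on the family `o`. -/
def restrictedYoneda : E ⥤ (InducedCategory E o)ᵒᵖ ⥤ Type v :=
  yoneda ⋙ (Functor.whiskeringLeft _ _ _).obj (inducedFunctor o).op

variable [IsGrothendieckTopos E] [(inducedFunctor o).IsCoverDense (epiTopology E)]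

lemma bijective_restrictedYoneda_map (X Y : E) :
    Function.Bijective ((restrictedYoneda o).map : (X ⟶ Y) → _) :=
  (Functor.whiskerLeft_obj_map_bijective_of_isCoverDense (epiTopology E) (inducedFunctor o)
    (yoneda.obj X) (yoneda.obj Y) ((isSheaf_iff_isSheaf_of_type _ _).2 (isSheaf_yoneda Y))).comp
    ⟨yoneda.map_injective, yoneda.map_surjective⟩

instance : (restrictedYoneda o).Full := ⟨fun {X Y} => (bijective_restrictedYoneda_map o X Y).2⟩

instance : (restrictedYoneda o).Faithful :=
  ⟨fun {X Y} => (bijective_restrictedYoneda_map o X Y).1⟩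

/-- A natural family of maps between the sets of arrows out of a dense family of objects comes from
an arrow. -/
lemma exists_hom_of_natural_family {X Y : E} (φ : ∀ i, (o i ⟶ X) → (o i ⟶ Y))
    (hφ : ∀ ⦃i j⦄ (k : o j ⟶ o i) x, φ j (k ≫ x) = k ≫ φ i x) :
    ∃ f : X ⟶ Y, ∀ i x, x ≫ f = φ i x := by
  let τ : (restrictedYoneda o).obj X ⟶ (restrictedYoneda o).obj Y :=
    { app := fun i => ↾(φ i.unop)
      naturality := fun i j k => by
        ext x
        exact hφ k.unop.hom x }
  obtain ⟨f, hf⟩ := (restrictedYoneda o).map_surjective τ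
  exact ⟨f, fun i x => congrArg (fun t => t.app (op i) x) hf⟩

end Restricted

section Limits

variable (E : Type u) [Category.{v} E] [IsGrothendieckTopos E]

instance hasFiniteLimits_of_isGrothendieckTopos : HasFiniteLimits E := by
  obtain ⟨C, _, J, ⟨e⟩⟩ := IsGrothendieckTopos.exists_site (E := E)
  exact ⟨fun K _ _ => Adjunction.hasLimitsOfShape_of_equivalence e.functor⟩

instance hasCoproducts_of_isGrothendieckTopos (ι : Type v) :
    HasColimitsOfShape (Discrete ι) E := by
  obtain ⟨C, _, J, ⟨e⟩⟩ := IsGrothendieckTopos.exists_site (E := E)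
  have : HasColimitsOfShape (Discrete ι) (Sheaf J (Type v)) :=
    hasColimitsOfShape_of_reflective (sheafToPresheaf J (Type v))
  exact Adjunction.hasColimitsOfShape_of_equivalence e.functor

/-- The geometric morphism given by global sections and constant sheaves. -/
theorem exists_geometricMorphism : Nonempty (GeometricMorphism E (Type v)) := by
  obtain ⟨C, _, J, ⟨e⟩⟩ := IsGrothendieckTopos.exists_site (E := E)
  have : PreservesLimits (Functor.const Cᵒᵖ : Type v ⥤ _) :=
    (colimConstAdj (J := Cᵒᵖ) (C := Type v)).rightAdjoint_preservesLimits
  have : PreservesFiniteLimits (constantSheaf J (Type v)) :=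
    inferInstanceAs (PreservesFiniteLimits (Functor.const Cᵒᵖ ⋙ presheafToSheaf J (Type v)))
  exact ⟨⟨_, _, (constantSheafΓAdj J (Type v)).comp e.symm.toAdjunction,
    comp_preservesFiniteLimits _ _⟩⟩

end Limits

namespace GeometricMorphism

variable {E : Type u} [Category.{v} E] (γ : GeometricMorphism E (Type v))

instance : PreservesFiniteLimits γ.inverseImage := γ.preservesFiniteLimits

instance : γ.inverseImage.IsLeftAdjoint := ⟨_, ⟨γ.adj⟩⟩

/-- The inverse image of the one-point set is terminal. -/
noncomputable def isTerminal : IsTerminal (γ.inverseImage.obj PUnit.{v + 1}) :=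
  IsTerminal.isTerminalObj _ _ Types.isTerminalPUnit

/-- The arrow `X ⟶ γ^* S` which is constant with value `s : S`. -/
noncomputable def constHom (X : E) {S : Type v} (s : S) : X ⟶ γ.inverseImage.obj S :=
  γ.isTerminal.from X ≫ γ.inverseImage.map (↾fun _ => s)

@[simp]
lemma comp_constHom {X Y : E} (f : Y ⟶ X) {S : Type v} (s : S) :
    f ≫ γ.constHom X s = γ.constHom Y s := by
  rw [constHom, constHom, ← Category.assoc, γ.isTerminal.hom_ext (f ≫ _) (γ.isTerminal.from Y)]

@[simp]
lemma constHom_map (X : E) {S T : Type v} (s : S) (f : S ⟶ T) :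
    γ.constHom X s ≫ γ.inverseImage.map f = γ.constHom X (f s) := by
  rw [constHom, constHom, Category.assoc, ← Functor.map_comp]
  rfl

lemma map_const_eq {S : Type v} (s : S) :
    γ.inverseImage.map (↾fun _ : PUnit.{v + 1} => s) = γ.constHom _ s := by
  rw [constHom, γ.isTerminal.hom_ext (γ.isTerminal.from _) (𝟙 _), Category.id_comp]

/-- Locally, every arrow to `γ^* S` is constant. -/
lemma isCoveringFamily_constHom (S : Type v) :
    IsCoveringFamily (fun _ : S => γ.inverseImage.obj PUnit.{v + 1})
      (fun s => γ.constHom _ s) := by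
  intro Z g h hgh
  apply (γ.adj.homEquiv _ _).injective
  ext s
  have := congrArg (γ.adj.homEquiv _ _) (hgh s)
  dsimp only at this
  rw [← map_const_eq, γ.adj.homEquiv_naturality_left, γ.adj.homEquiv_naturality_left] at this
  exact congrArg (fun t => t PUnit.unit) this

variable [IsGrothendieckTopos E]

/-- Constant arrows with distinct values agree only on an initial object. -/
lemma bot_mem_of_constHom_eq {X : E} {S : Type v} {s t : S} (hst : s ≠ t)
    (h : γ.constHom X s = γ.constHom X t) : ⊥ ∈ epiTopology E X := by
  -- In sets, the two points have empty intersection, and `γ^*` preserves this fact.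
  have hp : IsPullback (C := Type v) (↾(PEmpty.elim : PEmpty.{v + 1} → PUnit.{v + 1}))
      (↾(PEmpty.elim : PEmpty.{v + 1} → PUnit.{v + 1})) (↾fun _ => s) (↾fun _ => t) := by
    rw [Types.isPullback_iff]
    exact ⟨by ext x; exact x.elim, fun x => x.elim, fun _ _ h => (hst h).elim⟩
  have hp' := hp.map γ.inverseImage
  refine bot_mem_of_hom (hp'.lift _ _ h) (nonempty_isInitial_iff.1 ?_)
  exact ⟨IsInitial.isInitialObj _ _ Types.isInitialPEmpty⟩

/-- The part of `A` on which `g : A ⟶ γ^* S` takes the value `s`. -/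
noncomputable def fiber {A : E} {S : Type v} (g : A ⟶ γ.inverseImage.obj S) (s : S) : E :=
  pullback g (γ.constHom (γ.inverseImage.obj PUnit.{v + 1}) s)

/-- The inclusion of a fiber. -/
noncomputable def fiberι {A : E} {S : Type v} (g : A ⟶ γ.inverseImage.obj S) (s : S) :
    γ.fiber g s ⟶ A :=
  pullback.fst _ _

instance {A : E} {S : Type v} (g : A ⟶ γ.inverseImage.obj S) (s : S) : Mono (γ.fiberι g s) := by
  have := γ.isTerminal.mono_from (γ.constHom (γ.inverseImage.obj PUnit.{v + 1}) s)
  exact pullback.fst_of_mono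

lemma fiberι_comp {A : E} {S : Type v} (g : A ⟶ γ.inverseImage.obj S) (s : S) :
    γ.fiberι g s ≫ g = γ.constHom _ s :=
  pullback.condition.trans (γ.comp_constHom _ _)

lemma exists_fiber_lift {A W : E} {S : Type v} {g : A ⟶ γ.inverseImage.obj S} {s : S} {k : W ⟶ A}
    (h : k ≫ g = γ.constHom W s) : ∃ l, l ≫ γ.fiberι g s = k :=
  ⟨pullback.lift k (γ.isTerminal.from W) (by rw [h, comp_constHom]), pullback.lift_fst _ _ _⟩

lemma isCoveringFamily_fiberι {A : E} {S : Type v} (g : A ⟶ γ.inverseImage.obj S) :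
    IsCoveringFamily (γ.fiber g) (γ.fiberι g) := by
  refine isCoveringFamily_of_mem ((epiTopology E).pullback_stable g
    (isCoveringFamily_iff.1 (γ.isCoveringFamily_constHom S))) ?_
  rintro W k ⟨_, a, _, ⟨s⟩, h⟩
  exact ⟨s, γ.exists_fiber_lift (h.symm.trans (γ.comp_constHom a s))⟩

/-- An arrow from an indecomposable object to `γ^* S` is constant. -/
lemma exists_eq_constHom {A : E} (hA : IsIndecomposableObject A) {S : Type v}
    (g : A ⟶ γ.inverseImage.obj S) : ∃ s, g = γ.constHom A s := by
  have hne : ⊥ ∉ epiTopology E A := fun h => by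
    obtain ⟨h'⟩ := nonempty_isInitial_iff.2 h
    exact hA.1.false h'
  have hcov := isCoveringFamily_iff.1 (γ.isCoveringFamily_fiberι g)
  obtain ⟨s, hs⟩ : ∃ s, ⊥ ∉ epiTopology E (γ.fiber g s) := by
    by_contra! H
    refine hne (bot_mem_of_cover hcov ?_)
    rintro B _ ⟨_, a, _, ⟨s⟩, rfl⟩
    exact bot_mem_of_hom a (H s)
  classical
  -- The fibers over `s` and over its complement decompose `A`.
  let b : S ⟶ ULift.{v} Bool := ↾fun t => ⟨decide (t = s)⟩
  let g' := g ≫ γ.inverseImage.map b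
  obtain ⟨hc⟩ := nonempty_isColimit_binaryCofan (γ.fiberι g' ⟨true⟩) (γ.fiberι g' ⟨false⟩)
    (isCoveringFamily_iff.1 (γ.isCoveringFamily_fiberι g')) (by
      rintro W _ ⟨_, a, _, ⟨⟨_ | _⟩⟩, rfl⟩
      exacts [.inr ⟨a, rfl⟩, .inl ⟨a, rfl⟩]) (by
      intro W x y hxy
      refine γ.bot_mem_of_constHom_eq (S := ULift.{v} Bool) (s := ⟨true⟩) (t := ⟨false⟩)
        (by simp) ?_
      rw [← γ.comp_constHom x, ← fiberι_comp, ← Category.assoc, hxy, Category.assoc, fiberι_comp,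
        comp_constHom])
  have hlift {t : S} : ∃ l, l ≫ γ.fiberι g' (b t) = γ.fiberι g t :=
    γ.exists_fiber_lift (by rw [← Category.assoc, fiberι_comp, constHom_map])
  have hfalse : ⊥ ∈ epiTopology E (γ.fiber g' ⟨false⟩) := by
    refine nonempty_isInitial_iff.1 ((hA.2 _ _ ⟨hc⟩).resolve_left fun h => hs ?_)
    obtain ⟨l, -⟩ := hlift (t := s)
    have : b s = ⟨true⟩ := by simp [b]
    rw [this] at l
    exact bot_mem_of_hom l (nonempty_isInitial_iff.1 h)
  refine ⟨s, γ.isCoveringFamily_fiberι g _ _ fun t => ?_⟩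
  by_cases hts : t = s
  · rw [hts, fiberι_comp, comp_constHom]
  · obtain ⟨l, -⟩ := hlift (t := t)
    have : b t = ⟨false⟩ := by simp [b, hts]
    rw [this] at l
    exact hom_eq_of_bot_mem (bot_mem_of_hom l hfalse) _ _

lemma constHom_injective {A : E} (hA : IsEmpty (IsInitial A)) {S : Type v} :
    Function.Injective (γ.constHom A (S := S)) := by
  intro s t hst
  by_contra h
  obtain ⟨h'⟩ := nonempty_isInitial_iff.2 (γ.bot_mem_of_constHom_eq h hst)
  exact hA.false h'

lemma bijective_constHom {A : E} (hA : IsIndecomposableObject A) (S : Type v) :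
    Function.Bijective (γ.constHom A (S := S)) :=
  ⟨γ.constHom_injective hA.1, fun g => (γ.exists_eq_constHom hA g).imp fun _ h => h.symm⟩

end GeometricMorphism

section LocallyConnected

variable {E : Type u} [Category.{v} E] [IsGrothendieckTopos E]

/-- A separating set is the range of a family indexed by a type in the universe of the arrows. -/
lemma IsSeparatingSet.exists_family {E : Type u} [Category.{v} E] {P : ObjectProperty E}
    (hP : IsSeparatingSet P) : ∃ (I : Type v) (o : I → E), P = ObjectProperty.ofObj o := by
  have : Small.{v} (Subtype P) := hP.1
  refine ⟨Shrink.{v} (Subtype P), fun i => ((equivShrink _).symm i).1, ?_⟩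
  ext X
  constructor
  · intro h
    have := ObjectProperty.ofObj_apply
      (fun i : Shrink.{v} (Subtype P) => ((equivShrink _).symm i).1) (equivShrink _ ⟨X, h⟩)
    simpa using this
  · rintro ⟨i⟩
    exact ((equivShrink _).symm i).2

/-- If a separating family consists of indecomposable objects then, on arrows out of that family,
`γ^*` is the constant presheaf functor.  Its left adjoint is therefore the colimit functor. -/
lemma isRightAdjoint_inverseImage (γ : GeometricMorphism E (Type v)) {I : Type v} (o : I → E)
    [(inducedFunctor o).IsCoverDense (epiTopology E)]
    (h : ∀ i, IsIndecomposableObject (o i)) : γ.inverseImage.IsRightAdjoint := by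
  let α : Functor.const (InducedCategory E o)ᵒᵖ ≅ γ.inverseImage ⋙ restrictedYoneda o :=
    NatIso.ofComponents (fun S => NatIso.ofComponents
      (fun i => (Equiv.ofBijective _ (γ.bijective_constHom (h i.unop) S)).toIso)
      fun {i j} k => by
        ext s
        exact (γ.comp_constHom (inducedFunctor o |>.map k.unop) s).symm)
      fun {S T} f => by
        ext i s
        exact (γ.constHom_map _ s f).symm
  exact ⟨_, ⟨Adjunction.restrictFullyFaithful (iC := restrictedYoneda o) (iD := 𝟭 (Type v))
    colimConstAdj (.ofFullyFaithful _) (.ofFullyFaithful _)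
    (L := restrictedYoneda o ⋙ colim) (Functor.rightUnitor _).symm
    ((Functor.leftUnitor _).trans α)⟩⟩

end LocallyConnected

/-! ### Locally connected and connected toposes -/

section LocallyConnected

variable {E : Type u} [Category.{v} E]

/-- Arrows defined on the fibers of an arrow to `γ^* S` glue. -/
lemma GeometricMorphism.exists_glue_fiber [IsGrothendieckTopos E]
    (γ : GeometricMorphism E (Type v)) {A T : E} {S : Type v}
    (g : A ⟶ γ.inverseImage.obj S) (f : ∀ s, γ.fiber g s ⟶ T) :
    ∃ l : A ⟶ T, ∀ s, γ.fiberι g s ≫ l = f s := by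
  refine exists_glue (γ.isCoveringFamily_fiberι g) f fun s t W a b hab => ?_
  by_cases hst : s = t
  · subst hst
    rw [(cancel_mono _).1 hab]
  · refine hom_eq_of_bot_mem (γ.bot_mem_of_constHom_eq hst ?_) _ _
    rw [← γ.comp_constHom a, ← γ.comp_constHom b, ← γ.fiberι_comp g, ← γ.fiberι_comp g,
      ← Category.assoc, hab, Category.assoc]

lemma IsSeparatingSet.of_family {I : Type v} (o : I → E)
    (h : (ObjectProperty.ofObj o).IsSeparating) : IsSeparatingSet (ObjectProperty.ofObj o) :=
  ⟨inferInstance, h⟩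

lemma not_bot_mem_iff [IsGrothendieckTopos E] {A : E} :
    IsEmpty (IsInitial A) ↔ ⊥ ∉ epiTopology E A := by
  rw [← nonempty_isInitial_iff, not_nonempty_iff]

/-- An object is indecomposable if its arrows to `γ^* 2` are constant. -/
lemma isIndecomposableObject_of_eq_constHom [IsGrothendieckTopos E]
    (γ : GeometricMorphism E (Type v)) {A : E} (hA : ⊥ ∉ epiTopology E A)
    (h : ∀ g : A ⟶ γ.inverseImage.obj (ULift.{v} Bool), ∃ s, g = γ.constHom A s) :
    IsIndecomposableObject A := by
  refine ⟨not_bot_mem_iff.2 hA, fun Y Z i j ⟨hc⟩ => ?_⟩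
  let g : A ⟶ γ.inverseImage.obj (ULift.{v} Bool) := hc.desc (BinaryCofan.mk
    (γ.constHom Y (⟨true⟩ : ULift.{v} Bool)) (γ.constHom Z (⟨false⟩ : ULift.{v} Bool)))
  have hi : i ≫ g = γ.constHom Y ⟨true⟩ := hc.fac _ ⟨.left⟩
  have hj : j ≫ g = γ.constHom Z ⟨false⟩ := hc.fac _ ⟨.right⟩
  obtain ⟨s, hs⟩ := h g
  rw [hs, γ.comp_constHom] at hi hj
  rw [nonempty_isInitial_iff, nonempty_isInitial_iff]
  obtain ⟨_ | _⟩ := s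
  · exact .inl (γ.bot_mem_of_constHom_eq (by simp) hi)
  · exact .inr (γ.bot_mem_of_constHom_eq (by simp) hj)

/-- The fibers of the unit `X ⟶ γ^* (L X)`, where `L` is left adjoint to `γ^*`, are the connected
components of `X`.  They cannot be decomposed further because an arrow from `X` to `γ^* S` factors
through the unit, hence is constant on each of them. -/
lemma isIndecomposableObject_fiber_unit [IsGrothendieckTopos E]
    (γ : GeometricMorphism E (Type v)) {L : E ⥤ Type v} (adj : L ⊣ γ.inverseImage) (X : E)
    (p : L.obj X) : IsIndecomposableObject (γ.fiber (adj.unit.app X) p) := by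
  classical
  have hconst {S : Type v} (g : X ⟶ γ.inverseImage.obj S) :
      ∃ s, γ.fiberι (adj.unit.app X) p ≫ g = γ.constHom _ s := by
    obtain ⟨φ, rfl⟩ := (adj.homEquiv _ _).surjective g
    exact ⟨φ p, by
      rw [adj.homEquiv_unit, ← Category.assoc, γ.fiberι_comp, γ.constHom_map]⟩
  refine isIndecomposableObject_of_eq_constHom γ (fun h => ?_) fun f => ?_
  · -- If the fiber over `p` were initial, the indicator function of the complement of `p` and the
    -- constant function would have the same adjunct, since they differ only at `p`.
    let φ : L.obj X ⟶ ULift.{v} Bool := ↾fun _ => ⟨true⟩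
    let ψ : L.obj X ⟶ ULift.{v} Bool := ↾fun t => ⟨decide (t ≠ p)⟩
    have hφψ : φ = ψ := by
      apply (adj.homEquiv _ _).injective
      refine γ.isCoveringFamily_fiberι (adj.unit.app X) _ _ fun t => ?_
      by_cases ht : t = p
      · subst ht
        exact hom_eq_of_bot_mem h _ _
      · rw [adj.homEquiv_unit, adj.homEquiv_unit, ← Category.assoc, ← Category.assoc,
          γ.fiberι_comp, γ.constHom_map, γ.constHom_map]
        congr 1
        simp [φ, ψ, ht]
    simpa [φ, ψ] using congrArg (fun f => (f p).down) hφψ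
  · -- Extend `f` to all of `X`, so as to apply `hconst`.
    obtain ⟨g, hg⟩ := γ.exists_glue_fiber (adj.unit.app X)
      (Function.update (fun t => γ.constHom _ ⟨true⟩) p f)
    obtain ⟨s, hs⟩ := hconst g
    exact ⟨s, by rw [← hs]; exact ((hg p).trans (Function.update_self ..)).symm⟩

theorem isLocallyConnectedTopos_iff [IsGrothendieckTopos E] :
    IsLocallyConnectedTopos E ↔
      ∃ P : ObjectProperty E, IsSeparatingSet P ∧ ∀ A, P A → IsIndecomposableObject A := by
  constructor
  · rintro ⟨γ, ⟨L, ⟨adj⟩⟩⟩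
    obtain ⟨C, _, J, ⟨e⟩⟩ := IsGrothendieckTopos.exists_site (E := E)
    let o : (Σ c : C, L.obj ((generator e).obj c)) → E := fun p =>
      γ.fiber (adj.unit.app ((generator e).obj p.1)) p.2
    refine ⟨.ofObj o, .of_family o fun X Y f g hfg => ?_, ?_⟩
    · refine generator_hom_ext e fun c x =>
        γ.isCoveringFamily_fiberι (adj.unit.app _) _ _ fun p => ?_
      exact (Category.assoc ..).symm.trans ((hfg _ (ObjectProperty.ofObj_apply o ⟨c, p⟩)
        (γ.fiberι _ p ≫ x)).trans (Category.assoc ..))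
    · rintro _ ⟨p⟩
      exact isIndecomposableObject_fiber_unit γ adj _ _
  · rintro ⟨P, hP, h⟩
    obtain ⟨I, o, rfl⟩ := hP.exists_family
    have := isCoverDense_inducedFunctor hP.2
    obtain ⟨γ⟩ := exists_geometricMorphism E
    exact ⟨γ, isRightAdjoint_inverseImage γ o fun i => h _ (ObjectProperty.ofObj_apply o i)⟩

/-- If `γ^*` is full and faithful, the terminal object is indecomposable: its arrows to `γ^* 2` come
from functions, hence are constant. -/
lemma isIndecomposableObject_of_full [IsGrothendieckTopos E] (γ : GeometricMorphism E (Type v))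
    [γ.inverseImage.Full] [γ.inverseImage.Faithful] :
    IsIndecomposableObject (γ.inverseImage.obj PUnit.{v + 1}) := by
  refine isIndecomposableObject_of_eq_constHom γ (fun h => ?_) fun g => ?_
  · obtain ⟨h⟩ := nonempty_isInitial_iff.2 h
    exact (γ.inverseImage.preimage (h.to (γ.inverseImage.obj PEmpty.{v + 1})) PUnit.unit).elim
  · obtain ⟨φ, rfl⟩ := γ.inverseImage.map_surjective g
    exact ⟨φ PUnit.unit, (γ.map_const_eq (φ PUnit.unit)).symm ▸ rfl⟩

/-- If the terminal object is indecomposable, its arrows to `γ^* S` are the elements of `S`. -/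
lemma full_and_faithful_of_isIndecomposableObject [IsGrothendieckTopos E]
    (γ : GeometricMorphism E (Type v)) {T : E} (hT : IsTerminal T)
    (h : IsIndecomposableObject T) : γ.inverseImage.Full ∧ γ.inverseImage.Faithful := by
  refine ⟨⟨fun {S S'} f => ?_⟩, ⟨fun {S S'} f g hfg => ?_⟩⟩
  · choose φ hφ using fun s => γ.exists_eq_constHom h (γ.constHom T s ≫ f)
    refine ⟨↾φ, γ.isCoveringFamily_constHom S _ _ fun s => ?_⟩
    dsimp only
    rw [γ.constHom_map, ← γ.comp_constHom (hT.from _) s, Category.assoc, hφ, γ.comp_constHom]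
    rfl
  · ext s
    apply γ.constHom_injective h.1
    have := γ.constHom_map T s f
    rw [hfg, γ.constHom_map] at this
    exact this.symm

theorem isConnectedTopos_and_isLocallyConnectedTopos_iff [IsGrothendieckTopos E] :
    (IsConnectedTopos E ∧ IsLocallyConnectedTopos E) ↔
      ∃ P : ObjectProperty E, IsSeparatingSet P ∧
        (∀ A, P A → IsIndecomposableObject A) ∧ ContainsTerminal P := by
  constructor
  · rintro ⟨⟨γ, _, _⟩, hE⟩
    obtain ⟨P, hP, h⟩ := isLocallyConnectedTopos_iff.1 hE
    have hsmall := hP.1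
    refine ⟨P ⊔ .singleton (γ.inverseImage.obj PUnit.{v + 1}),
      ⟨inferInstance, hP.2.of_le le_sup_left⟩, ?_, _, Or.inr ?_, ⟨γ.isTerminal⟩⟩
    · rintro A (hA | hA)
      · exact h A hA
      · obtain rfl : γ.inverseImage.obj PUnit.{v + 1} = A := by simpa using hA
        exact isIndecomposableObject_of_full γ
    · simp
  · rintro ⟨P, hP, h, T, hPT, ⟨hT⟩⟩
    refine ⟨?_, isLocallyConnectedTopos_iff.2 ⟨P, hP, h⟩⟩
    obtain ⟨γ⟩ := exists_geometricMorphism E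
    exact ⟨γ, full_and_faithful_of_isIndecomposableObject γ hT (h T hPT)⟩

end LocallyConnected

/-! ### Atomic toposes -/

section Atomic

variable {E : Type u} [Category.{v} E]

lemma isCoveringFamily_sigmaι {ι : Type v} (U : ι → E) [HasCoproduct U] :
    IsCoveringFamily U (Sigma.ι U) := fun _ _ _ h => Sigma.hom_ext _ _ h

lemma generator_isSeparating {C : Type v} [SmallCategory C] {J : GrothendieckTopology C}
    (e : E ≌ Sheaf J (Type v)) : (ObjectProperty.ofObj (generator e).obj).IsSeparating :=
  fun _ _ _ _ h => generator_hom_ext e fun c x => h _ (ObjectProperty.ofObj_apply _ c) x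

variable [IsGrothendieckTopos E]

instance balanced_of_isGrothendieckTopos : Balanced E where
  isIso_of_mono_of_epi {X Y} f _ _ := by
    have hf : IsCoveringFamily (fun _ : Unit => X) (fun _ => f) := fun Z g h hgh =>
      (cancel_epi f).1 (hgh ⟨⟩)
    refine isIso_of_mono_of_mem f (isCoveringFamily_iff.1 hf) ?_
    rintro W _ ⟨_, a, _, ⟨_⟩, rfl⟩
    exact ⟨a, rfl⟩

instance wellPowered_of_isGrothendieckTopos : WellPowered.{v} E := by
  obtain ⟨C, _, J, ⟨e⟩⟩ := IsGrothendieckTopos.exists_site (E := E)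
  exact wellPowered_of_isDetecting (generator_isSeparating e).isDetecting

/-- A small family of monomorphisms which represents all subobjects of `X`. -/
lemma exists_family_of_subobjects (X : E) : ∃ (A : Type v) (U : A → E) (u : ∀ a, U a ⟶ X),
    (∀ a, Mono (u a)) ∧ ∀ ⦃V : E⦄ (m : V ⟶ X), Mono m →
      ∃ a, (∃ f, f ≫ u a = m) ∧ ∃ g, g ≫ m = u a := by
  let σ := (equivShrink.{v} (Subobject X)).symm
  refine ⟨Shrink.{v} (Subobject X), fun a => σ a, fun a => (σ a).arrow, fun a => inferInstance,
    fun V m _ => ?_⟩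
  obtain ⟨a, ha⟩ := σ.surjective (Subobject.mk m)
  refine ⟨a, ?_⟩
  change (∃ f, f ≫ (σ a).arrow = m) ∧ ∃ g, g ≫ m = (σ a).arrow
  rw [ha]
  exact ⟨⟨_, Subobject.underlyingIso_arrow m⟩, ⟨_, Subobject.underlyingIso_hom_comp_eq_mk m⟩⟩

/-- The membership relation is the power object of a set. -/
lemma isPowerObject_membership (A : Type v) :
    IsPowerObject (E := Type v) (M := {x : Set A × A // x.2 ∈ x.1}) (↾fun x => x.1.1)
      (↾fun x => x.1.2) where
  jointlyMono := ⟨fun Y f g h₁ h₂ => by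
    refine ConcreteCategory.hom_ext _ _ fun y => ?_
    exact Subtype.ext (Prod.ext (congrArg (fun t => t y) h₁) (congrArg (fun t => t y) h₂))⟩
  existsUnique_classifying B R r s hrs := by
    have hinj (x y : R) (h₁ : r x = r y) (h₂ : s x = s y) : x = y :=
      congrArg (fun f => f PUnit.unit) (hrs.right_cancellation (Y := PUnit.{v + 1})
        (↾fun _ => x) (↾fun _ => y) (by ext; exact h₁) (by ext; exact h₂))
    refine ⟨↾fun b => {a | ∃ x, r x = b ∧ s x = a},
      ⟨↾fun x => ⟨({a | ∃ y, r y = r x ∧ s y = a}, s x), x, rfl, rfl⟩, ?_, rfl⟩, ?_⟩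
    · rw [Types.isPullback_iff]
      refine ⟨rfl, fun x y ⟨h₁, h₂⟩ => hinj x y h₂ ?_, ?_⟩
      · exact congrArg (fun z => z.1.2) h₁
      · rintro ⟨⟨T, a⟩, ha⟩ b hT
        replace hT : T = _ := hT
        subst hT
        have ⟨x, hx, hx'⟩ := ha
        refine ⟨x, Subtype.ext (Prod.ext ?_ hx'), hx⟩
        change {a | ∃ y, r y = r x ∧ s y = a} = {a | ∃ y, r y = b ∧ s y = a}
        rw [show r x = b from hx]
    · rintro χ ⟨t, ht, hts⟩
      rw [Types.isPullback_iff] at ht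
      obtain ⟨h₁, -, h₃⟩ := ht
      ext b a
      constructor
      · intro ha
        obtain ⟨x, hx, hx'⟩ := h₃ ⟨(χ b, a), ha⟩ b rfl
        exact ⟨x, hx', by rw [← hts]; exact congrArg (fun z => z.1.2) hx⟩
      · rintro ⟨x, rfl, rfl⟩
        have h₁' : (t x).1.1 = χ (r x) := congrArg (fun f => f x) h₁
        have h₂' : (t x).1.2 = s x := congrArg (fun f => f x) hts
        change s x ∈ χ (r x)
        rw [← h₁', ← h₂']
        exact (t x).2

/-- If `γ^*` preserves power objects, then every object `X` of the topos has an arrow to some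
`γ^* S` whose fibers are atoms or initial, so that `X` is covered by atoms.

Let `U a`, `a : A`, be all the subobjects of `X`.  They form a relation from `X` to `γ^* A`, which
is classified by an arrow `χ : X ⟶ γ^* (Set A)`.  On the part of `X` where `χ` takes the value
`T`, the subobject `U a` is everything if `a ∈ T`, and nothing otherwise. -/
lemma exists_cover_by_atoms {γ : GeometricMorphism E (Type v)}
    (hγ : IsLogicalFunctor γ.inverseImage) (X : E) :
    ∃ (S : Type v) (χ : X ⟶ γ.inverseImage.obj S), ∀ T ⦃V : E⦄ (m : V ⟶ γ.fiber χ T), Mono m →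
      IsIso m ∨ Nonempty (IsInitial V) := by
  obtain ⟨A, U, u, hu, hU⟩ := exists_family_of_subobjects X
  let r : ∐ U ⟶ X := Sigma.desc u
  let s : ∐ U ⟶ γ.inverseImage.obj A := Sigma.desc fun a => γ.constHom (U a) a
  have hr (a : A) : Sigma.ι U a ≫ r = u a := Sigma.ι_desc _ _
  have hs (a : A) : Sigma.ι U a ≫ s = γ.constHom _ a := Sigma.ι_desc _ _
  have hcov := isCoveringFamily_iff.1 (isCoveringFamily_sigmaι U)
  have hrs : JointlyMono₂ r s := by
    refine ⟨fun W g h h₁ h₂ => ?_⟩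
    refine hom_ext_of_mem ((epiTopology E).intersection_covering
      ((epiTopology E).pullback_stable g hcov) ((epiTopology E).pullback_stable h hcov)) ?_
    rintro Y k ⟨⟨_, x, _, ⟨a⟩, hx⟩, ⟨_, y, _, ⟨b⟩, hy⟩⟩
    by_cases hab : a = b
    · subst hab
      rw [← hx, ← hy, (hu a).right_cancellation x y]
      rw [← hr, ← Category.assoc, ← Category.assoc, hx, hy, Category.assoc, Category.assoc, h₁]
    · refine hom_eq_of_bot_mem (γ.bot_mem_of_constHom_eq hab ?_) _ _
      rw [← γ.comp_constHom x, ← γ.comp_constHom y, ← hs, ← hs, ← Category.assoc,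
        ← Category.assoc, hx, hy, Category.assoc, Category.assoc, h₂]
  obtain ⟨χ, ⟨t, hp, hts⟩, -⟩ := (hγ.preservesPowerObjects _ _
    (isPowerObject_membership A)).existsUnique_classifying r s hrs
  refine ⟨Set A, χ, fun T V m hm => ?_⟩
  obtain ⟨a, ⟨f, hf⟩, ⟨g, hg⟩⟩ := hU (m ≫ γ.fiberι χ T) inferInstance
  by_cases haT : a ∈ T
  · left
    let l := hp.lift (γ.constHom (γ.fiber χ T) ⟨(T, a), haT⟩) (γ.fiberι χ T) (by
      rw [γ.constHom_map, γ.fiberι_comp]; rfl)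
    have hlt : l ≫ t = γ.constHom _ ⟨(T, a), haT⟩ := hp.lift_fst _ _ _
    have hlr : l ≫ r = γ.fiberι χ T := hp.lift_snd _ _ _
    have hls : l ≫ s = γ.constHom _ a := by
      rw [← hts, ← Category.assoc, hlt, γ.constHom_map]; rfl
    refine isIso_of_mono_of_mem m ((epiTopology E).pullback_stable l hcov) ?_
    rintro W k ⟨_, x, _, ⟨b⟩, hx⟩
    by_cases hab : a = b
    · subst hab
      refine ⟨x ≫ g, ?_⟩
      rw [← cancel_mono (γ.fiberι χ T), Category.assoc, Category.assoc, hg, ← hr,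
        ← Category.assoc, hx, Category.assoc, hlr]
    · have hW : ⊥ ∈ epiTopology E W := γ.bot_mem_of_constHom_eq hab (by
        rw [← γ.comp_constHom k, ← hls, ← Category.assoc, ← hx, Category.assoc, hs,
          γ.comp_constHom])
      obtain ⟨hW'⟩ := nonempty_isInitial_iff.2 hW
      exact ⟨hW'.to V, hW'.hom_ext _ _⟩
  · right
    have h₁ : ((f ≫ Sigma.ι U a) ≫ t) ≫ γ.inverseImage.map (↾fun x => x.1.1) =
        γ.constHom V T := by
      rw [Category.assoc, hp.w, Category.assoc, ← Category.assoc (Sigma.ι U a), hr,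
        ← Category.assoc, hf, Category.assoc, γ.fiberι_comp, γ.comp_constHom]
    have h₂ : ((f ≫ Sigma.ι U a) ≫ t) ≫ γ.inverseImage.map (↾fun x => x.1.2) =
        γ.constHom V a := by
      rw [Category.assoc, hts, Category.assoc, hs, γ.comp_constHom]
    refine nonempty_isInitial_iff.2 (bot_mem_of_cover (isCoveringFamily_iff.1
      (γ.isCoveringFamily_fiberι ((f ≫ Sigma.ι U a) ≫ t))) ?_)
    rintro Y _ ⟨_, x, _, ⟨⟨⟨T', a'⟩, h⟩⟩, rfl⟩
    refine bot_mem_of_hom x ?_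
    replace h₁ := congrArg (fun z => γ.fiberι ((f ≫ Sigma.ι U a) ≫ t) ⟨(T', a'), h⟩ ≫ z) h₁
    replace h₂ := congrArg (fun z => γ.fiberι ((f ≫ Sigma.ι U a) ≫ t) ⟨(T', a'), h⟩ ≫ z) h₂
    rw [← Category.assoc, γ.fiberι_comp, γ.constHom_map, γ.comp_constHom] at h₁ h₂
    by_cases haa : a' = a
    · exact γ.bot_mem_of_constHom_eq (fun hT => haT (by rw [← hT, ← haa]; exact h)) h₁
    · exact γ.bot_mem_of_constHom_eq haa h₂

/-- Every subset of `A` is named by exactly one element of a power object of `A` in sets. -/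
lemma IsPowerObject.existsUnique_name {A P M : Type v} {p : M ⟶ P} {q : M ⟶ A}
    (h : IsPowerObject p q) (T : Set A) : ∃! x : P, ∀ a, a ∈ T ↔ ∃ m, p m = x ∧ q m = a := by
  have hinj (m n : M) (h₁ : p m = p n) (h₂ : q m = q n) : m = n :=
    congrArg (fun f => f PUnit.unit) (h.jointlyMono.right_cancellation (Y := PUnit.{v + 1})
      (↾fun _ => m) (↾fun _ => n) (by ext; exact h₁) (by ext; exact h₂))
  have hjm : JointlyMono₂ (C := Type v) (↾fun _ : T => PUnit.unit.{v + 1}) (↾fun a : T => a.1) :=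
    ⟨fun Y f g _ h₂ => by
      ext y
      exact congrArg (fun t => t y) h₂⟩
  obtain ⟨χ, ⟨t, ht, hts⟩, huniq⟩ := h.existsUnique_classifying _ _ hjm
  rw [Types.isPullback_iff] at ht
  obtain ⟨h₁, -, h₃⟩ := ht
  refine ⟨χ PUnit.unit, fun a => ⟨fun ha => ?_, ?_⟩, fun x hx => ?_⟩
  · exact ⟨t ⟨a, ha⟩, congrArg (fun f => f ⟨a, ha⟩) h₁, congrArg (fun f => f ⟨a, ha⟩) hts⟩
  · rintro ⟨m, hm, rfl⟩
    obtain ⟨⟨a, ha⟩, rfl, -⟩ := h₃ m PUnit.unit hm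
    have : q (t ⟨a, ha⟩) = a := congrArg (fun f => f ⟨a, ha⟩) hts
    rwa [this]
  · choose t' ht' hts' using fun a : T => (hx a.1).1 a.2
    refine congrArg (fun f => f PUnit.unit) (huniq (↾fun _ => x) ⟨↾t', ?_, by
      ext a
      exact hts' a⟩)
    rw [Types.isPullback_iff]
    refine ⟨by ext a; exact ht' a, fun a b ⟨hab, _⟩ => Subtype.ext ?_, fun m _ hm => ?_⟩
    · have : q (t' a) = q (t' b) := congrArg q hab
      rwa [hts', hts'] at this
    · have hm' : q m ∈ T := (hx _).2 ⟨m, hm, rfl⟩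
      exact ⟨⟨q m, hm'⟩, hinj _ _ ((ht' _).trans hm.symm) (hts' _), rfl⟩

lemma IsAtomObject.isIndecomposableObject (γ : GeometricMorphism E (Type v)) {A : E}
    (hA : IsAtomObject A) : IsIndecomposableObject A := by
  refine isIndecomposableObject_of_eq_constHom γ (not_bot_mem_iff.1 hA.1) fun g => ?_
  by_contra! H
  refine not_bot_mem_iff.1 hA.1
    (bot_mem_of_cover (isCoveringFamily_iff.1 (γ.isCoveringFamily_fiberι g)) ?_)
  rintro B _ ⟨_, a, _, ⟨s⟩, rfl⟩
  refine bot_mem_of_hom a (nonempty_isInitial_iff.1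
    ((hA.2 (γ.fiberι g s) inferInstance).resolve_left fun h => H s ?_))
  rw [← cancel_epi (γ.fiberι g s), γ.fiberι_comp, γ.comp_constHom]

/-- Factorization through a monomorphism may be checked on arrows out of a dense family. -/
lemma exists_lift_of_family {I : Type v} {o : I → E}
    [(inducedFunctor o).IsCoverDense (epiTopology E)] {Z Q W : E} (m : Q ⟶ Z) [Mono m] (g : W ⟶ Z)
    (h : ∀ i (w : o i ⟶ W), ∃ l, l ≫ m = w ≫ g) : ∃ l, l ≫ m = g := by
  refine exists_lift_of_mem m g ((inducedFunctor o).is_cover_of_isCoverDense (epiTopology E) W) ?_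
  rintro V _ ⟨⟨i, a, w, rfl⟩⟩
  obtain ⟨l, hl⟩ := h i w
  exact ⟨a ≫ l, by rw [Category.assoc, hl, Category.assoc]⟩

lemma hom_ext_of_family {I : Type v} {o : I → E}
    [(inducedFunctor o).IsCoverDense (epiTopology E)] {X Y : E} {f g : X ⟶ Y}
    (h : ∀ i (w : o i ⟶ X), w ≫ f = w ≫ g) : f = g := by
  refine hom_ext_of_mem ((inducedFunctor o).is_cover_of_isCoverDense (epiTopology E) X) ?_
  rintro V _ ⟨⟨i, a, w, rfl⟩⟩
  rw [Category.assoc, h i w, Category.assoc]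

lemma prodLift_eq_iff {C : Type*} [Category* C] {W X Y : C} [HasBinaryProduct X Y] {a b : W ⟶ X}
    {c d : W ⟶ Y} : prod.lift a c = prod.lift b d ↔ a = b ∧ c = d := by
  refine ⟨fun h => ⟨?_, ?_⟩, fun ⟨h₁, h₂⟩ => by rw [h₁, h₂]⟩
  · rw [← prod.lift_fst a c, h, prod.lift_fst]
  · rw [← prod.lift_snd a c, h, prod.lift_snd]

lemma mono_prodLift {C : Type*} [Category* C] {R X Y : C} [HasBinaryProduct X Y] {r : R ⟶ X}
    {s : R ⟶ Y} (h : JointlyMono₂ r s) : Mono (prod.lift r s) := by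
  refine ⟨fun f g hfg => ?_⟩
  rw [prod.comp_lift, prod.comp_lift, prodLift_eq_iff] at hfg
  exact h.right_cancellation f g hfg.1 hfg.2

lemma jointlyMono₂_map {R X Y : Type v} {r : R ⟶ X} {s : R ⟶ Y} (h : JointlyMono₂ r s)
    {D : Type*} [Category* D] [HasBinaryProducts D] (F : Type v ⥤ D) [PreservesFiniteLimits F] :
    JointlyMono₂ (F.map r) (F.map s) := by
  have := mono_prodLift h
  refine ⟨fun W f g h₁ h₂ => ?_⟩
  rw [← cancel_mono (F.map (prod.lift r s)), ← cancel_mono (prodComparison F X Y)]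
  refine Limits.prod.hom_ext ?_ ?_
  · rw [Category.assoc, Category.assoc, prodComparison_fst, Category.assoc, Category.assoc,
      prodComparison_fst, ← F.map_comp, prod.lift_fst, h₁]
  · rw [Category.assoc, Category.assoc, prodComparison_snd, Category.assoc, Category.assoc,
      prodComparison_snd, ← F.map_comp, prod.lift_snd, h₂]

/-- A relation between an atom and `γ^* A` cannot distinguish the points of the atom. -/
lemma exists_lift_of_isAtomObject {γ : GeometricMorphism E (Type v)} {A : Type v} {B R X Y : E}
    {r : R ⟶ B} {s : R ⟶ γ.inverseImage.obj A} (hrs : JointlyMono₂ r s) (hX : IsAtomObject X)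
    (hY : ⊥ ∉ epiTopology E Y) (k : Y ⟶ X) (b : X ⟶ B) (a : A) (y : Y ⟶ R) (hyr : y ≫ r = k ≫ b)
    (hys : y ≫ s = γ.constHom Y a) : ∃ x : X ⟶ R, x ≫ r = b ∧ x ≫ s = γ.constHom X a := by
  have := mono_prodLift hrs
  let m := pullback.fst (prod.lift b (γ.constHom X a)) (prod.lift r s)
  have hm : IsIso m := (hX.2 m inferInstance).resolve_right fun h => hY <| by
    refine bot_mem_of_hom (pullback.lift k y ?_) (nonempty_isInitial_iff.1 h)
    rw [prod.comp_lift, prod.comp_lift, prodLift_eq_iff]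
    exact ⟨hyr.symm, by rw [hys, γ.comp_constHom]⟩
  have hx : inv m ≫ pullback.snd _ _ ≫ prod.lift r s = prod.lift b (γ.constHom X a) := by
    rw [← pullback.condition, IsIso.inv_hom_id_assoc]
  rw [← Category.assoc, prod.comp_lift, prodLift_eq_iff] at hx
  exact ⟨inv m ≫ pullback.snd _ _, hx⟩

/-- If the topos has a separating family of atoms, then `γ^*` preserves power objects: on an atom a
relation to `γ^* A` is given by a subset of `A`. -/
lemma isPowerObject_inverseImage (γ : GeometricMorphism E (Type v)) {I : Type v} {o : I → E}
    [(inducedFunctor o).IsCoverDense (epiTopology E)] (ho : ∀ i, IsAtomObject (o i))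
    {A P M : Type v} {p : M ⟶ P} {q : M ⟶ A} (hpq : IsPowerObject p q) :
    IsPowerObject (γ.inverseImage.map p) (γ.inverseImage.map q) where
  jointlyMono := jointlyMono₂_map hpq.jointlyMono γ.inverseImage
  existsUnique_classifying B R r s hrs := by
    have hind i := (ho i).isIndecomposableObject γ
    -- `c i b` is the element of `P` which names the set of `a : A` related to the point `b` of `B`.
    choose c hc hc' using fun i (b : o i ⟶ B) =>
      hpq.existsUnique_name {a | ∃ x : o i ⟶ R, x ≫ r = b ∧ x ≫ s = γ.constHom _ a}
    obtain ⟨χ, hχ⟩ := exists_hom_of_natural_family o (fun i b => γ.constHom (o i) (c i b))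
      fun i j k b => by
        rw [γ.comp_constHom]
        congr 1
        refine (hc' j (k ≫ b) (c i b) fun a => Iff.trans ⟨?_, ?_⟩ (hc i b a)).symm
        · rintro ⟨y, hyr, hys⟩
          exact exists_lift_of_isAtomObject hrs (ho i) (not_bot_mem_iff.1 (ho j).1) k b a y hyr hys
        · rintro ⟨x, hxr, hxs⟩
          exact ⟨k ≫ x, by rw [Category.assoc, hxr], by
            rw [Category.assoc, hxs, γ.comp_constHom]⟩
    have hjm := jointlyMono₂_map hpq.jointlyMono γ.inverseImage
    refine ⟨χ, ?_, ?_⟩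
    · -- `R` and the pullback `Q` along `χ` contain each other as subobjects of `B ⨯ γ^* A`, because
      -- they have the same arrows from the atoms `o i`.
      let Q := pullback (γ.inverseImage.map p) χ
      let s' : Q ⟶ γ.inverseImage.obj A := pullback.fst _ _ ≫ γ.inverseImage.map q
      let r' : Q ⟶ B := pullback.snd _ _
      have hQ : JointlyMono₂ r' s' := by
        refine ⟨fun W f g h₁ h₂ => pullback.hom_ext (hjm.right_cancellation _ _ ?_ ?_) h₁⟩
        · rw [Category.assoc, Category.assoc, pullback.condition, ← Category.assoc,
            ← Category.assoc]
          exact congrArg (· ≫ χ) h₁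
        · simpa [s'] using h₂
      have := mono_prodLift hQ
      have := mono_prodLift hrs
      obtain ⟨f, hf⟩ := exists_lift_of_family (o := o) (prod.lift r' s') (prod.lift r s)
        fun i w => by
          obtain ⟨a, ha⟩ := γ.exists_eq_constHom (hind i) (w ≫ s)
          obtain ⟨m, hm, hma⟩ := (hc i (w ≫ r) a).1 ⟨w, rfl, ha⟩
          refine ⟨pullback.lift (γ.constHom _ m) (w ≫ r) ?_, ?_⟩
          · rw [hχ, γ.constHom_map, hm]
          · rw [prod.comp_lift, prod.comp_lift, prodLift_eq_iff]
            refine ⟨pullback.lift_snd _ _ _, ?_⟩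
            rw [← Category.assoc, pullback.lift_fst, γ.constHom_map, hma, ha]
      obtain ⟨g, hg⟩ := exists_lift_of_family (o := o) (prod.lift r s) (prod.lift r' s')
        fun i w => by
          obtain ⟨m, hm⟩ := γ.exists_eq_constHom (hind i) (w ≫ pullback.fst _ _)
          have hw : w ≫ pullback.fst _ _ ≫ γ.inverseImage.map p = (w ≫ r') ≫ χ := by
            rw [pullback.condition, Category.assoc]
          rw [← Category.assoc, hm, γ.constHom_map, hχ] at hw
          obtain ⟨x, hx, hx'⟩ := (hc i (w ≫ r') (q m)).2
            ⟨m, γ.constHom_injective (ho i).1 hw, rfl⟩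
          refine ⟨x, ?_⟩
          rw [prod.comp_lift, prod.comp_lift, prodLift_eq_iff, hx', ← Category.assoc w, hm,
            γ.constHom_map]
          exact ⟨hx, rfl⟩
      have hfrs := hf
      rw [prod.comp_lift, prodLift_eq_iff] at hfrs
      obtain ⟨hfr, hfs⟩ := hfrs
      have hfg : f ≫ g = 𝟙 R := by
        rw [← cancel_mono (prod.lift r s), Category.assoc, hg, hf, Category.id_comp]
      have hgf : g ≫ f = 𝟙 Q := by
        rw [← cancel_mono (prod.lift r' s'), Category.assoc, hf, hg, Category.id_comp]
      refine ⟨f ≫ pullback.fst _ _, ?_, by rw [Category.assoc]; exact hfs⟩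
      exact IsPullback.of_iso_pullback ⟨by
        rw [← hfr, Category.assoc, Category.assoc, pullback.condition]⟩ ⟨f, g, hfg, hgf⟩ rfl hfr
    · rintro χ' ⟨t, ht, hts⟩
      refine hom_ext_of_family (o := o) fun i b => ?_
      obtain ⟨x, hx⟩ := γ.exists_eq_constHom (hind i) (b ≫ χ')
      rw [hx, hχ, hc' i b x fun a => ⟨?_, ?_⟩]
      · rintro ⟨w, hw, hwa⟩
        obtain ⟨m, hm⟩ := γ.exists_eq_constHom (hind i) (w ≫ t)
        refine ⟨m, ?_, ?_⟩
        · apply γ.constHom_injective (ho i).1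
          rw [← γ.constHom_map, ← hm, Category.assoc, ht.w, ← Category.assoc, hw, hx]
        · apply γ.constHom_injective (ho i).1
          rw [← γ.constHom_map, ← hm, Category.assoc, hts, hwa]
      · rintro ⟨m, rfl, rfl⟩
        refine ⟨ht.lift (γ.constHom _ m) b (by rw [γ.constHom_map, hx]), ht.lift_snd _ _ _, ?_⟩
        rw [← hts, ← Category.assoc, ht.lift_fst, γ.constHom_map]

theorem isAtomicTopos_iff :
    IsAtomicTopos E ↔
      ∃ P : ObjectProperty E, IsSeparatingSet P ∧ ∀ A, P A → IsAtomObject A := by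
  constructor
  · rintro ⟨γ, hγ⟩
    obtain ⟨C, _, J, ⟨e⟩⟩ := IsGrothendieckTopos.exists_site (E := E)
    choose S χ hχ using fun c => exists_cover_by_atoms hγ ((generator e).obj c)
    let o : (Σ c : C, {s : S c // ⊥ ∉ epiTopology E (γ.fiber (χ c) s)}) → E := fun p =>
      γ.fiber (χ p.1) p.2.1
    refine ⟨.ofObj o, .of_family o fun X Y f g hfg => ?_, ?_⟩
    · refine generator_hom_ext e fun c x => γ.isCoveringFamily_fiberι (χ c) _ _ fun s => ?_
      by_cases hs : ⊥ ∈ epiTopology E (γ.fiber (χ c) s)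
      · exact hom_eq_of_bot_mem hs _ _
      · exact (Category.assoc ..).symm.trans ((hfg _ (ObjectProperty.ofObj_apply o ⟨c, s, hs⟩)
          (γ.fiberι _ s ≫ x)).trans (Category.assoc ..))
    · rintro _ ⟨p⟩
      exact ⟨not_bot_mem_iff.2 p.2.2, hχ _ _⟩
  · rintro ⟨P, hP, h⟩
    obtain ⟨I, o, rfl⟩ := hP.exists_family
    have := isCoverDense_inducedFunctor hP.2
    obtain ⟨γ⟩ := exists_geometricMorphism E
    exact ⟨γ, γ.preservesFiniteLimits, fun A P M p q hpq => isPowerObject_inverseImage γ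
      (fun i => h _ (ObjectProperty.ofObj_apply o i)) hpq⟩

end Atomic

/-! ### Compactness relative to a class of index types -/

/-- A class of index types which contains the one-element types and is closed under dependent
sums.  The two instances that matter are the finite types, which give compactness and coherence,
and the one-element types, which give supercompactness and regularity. -/
structure IsIndexClass (κ : Type → Prop) : Prop where
  unit : κ PUnit
  sigma : ∀ {T : Type} {S : T → Type}, κ T → (∀ t, κ (S t)) → κ (Σ t, S t)

lemma isIndexClass_finite : IsIndexClass fun T => Finite T where
  unit := inferInstance
  sigma _ _ := inferInstance

lemma isIndexClass_unique : IsIndexClass fun T => Nonempty (Unique T) where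
  unit := ⟨inferInstance⟩
  sigma {T S} := fun ⟨hT⟩ hS => by
    have := fun t => (hS t).some
    exact ⟨⟨⟨default, default⟩, by
      rintro ⟨t, s⟩
      obtain rfl := Subsingleton.elim t default
      exact Sigma.ext rfl (heq_of_eq (Subsingleton.elim s _))⟩⟩

section Compact

variable {E : Type u} [Category.{v} E] {κ : Type → Prop}

variable (κ) in
/-- `A` is compact with respect to `κ`: every small covering family contains a covering subfamily
indexed, possibly with repetitions, by a type in `κ`. -/
def IsCompactFor (A : E) : Prop :=
  ∀ ⦃ι : Type v⦄ (X : ι → E) (f : ∀ i, X i ⟶ A), IsCoveringFamily X f →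
    ∃ (T : Type) (σ : T → ι), κ T ∧ IsCoveringFamily (fun t => X (σ t)) (fun t => f (σ t))

variable (κ) in
/-- `A` is coherent with respect to `κ`: it is compact with respect to `κ`, and so is the pullback
of any two arrows to `A` with compact domain.  The condition on kernel pairs in the usual definition
is the case of two equal arrows. -/
def IsCoherentFor (A : E) : Prop :=
  IsCompactFor κ A ∧ ∀ ⦃X Y K : E⦄ ⦃x : X ⟶ A⦄ ⦃y : Y ⟶ A⦄ ⦃p : K ⟶ X⦄ ⦃q : K ⟶ Y⦄,
    IsCompactFor κ X → IsCompactFor κ Y → IsPullback p q x y → IsCompactFor κ K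

lemma isCompactObject_iff {A : E} : IsCompactObject A ↔ IsCompactFor (fun T => Finite T) A := by
  constructor
  · intro h ι X f hf
    obtain ⟨s, hs⟩ := h X f hf
    refine ⟨Fin s.card, fun t => s.equivFin.symm t, inferInstance, fun Z a b H => ?_⟩
    refine hs a b fun i => ?_
    obtain ⟨t, rfl⟩ := s.equivFin.symm.surjective i
    exact H t
  · intro h ι X f hf
    obtain ⟨T, σ, hT, hσ⟩ := h X f hf
    classical
    have := Fintype.ofFinite T
    exact ⟨Finset.univ.image σ, fun Z a b H => hσ a b fun t => H ⟨σ t, by simp⟩⟩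

lemma isSupercompactObject_iff {A : E} :
    IsSupercompactObject A ↔ IsCompactFor (fun T => Nonempty (Unique T)) A := by
  constructor
  · intro h ι X f hf
    obtain ⟨i, hi⟩ := h X f hf
    exact ⟨PUnit, fun _ => i, ⟨inferInstance⟩, fun Z a b H => (cancel_epi (f i)).1 (H ⟨⟩)⟩
  · intro h ι X f hf
    obtain ⟨T, σ, ⟨hT⟩, hσ⟩ := h X f hf
    refine ⟨σ default, ⟨fun a b H => hσ a b fun t => ?_⟩⟩
    obtain rfl := Subsingleton.elim t default
    exact H

lemma IsCoherentFor.isCoherentObject {A : E} (h : IsCoherentFor (fun T => Finite T) A) :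
    IsCoherentObject A :=
  ⟨isCompactObject_iff.2 h.1, fun _ _ _ _ _ hB hK => isCompactObject_iff.2
    (h.2 (isCompactObject_iff.1 hB) (isCompactObject_iff.1 hB) hK)⟩

lemma IsCoherentFor.isRegularObject {A : E} (h : IsCoherentFor (fun T => Nonempty (Unique T)) A) :
    IsRegularObject A :=
  ⟨isSupercompactObject_iff.2 h.1, fun _ _ _ _ _ hB hK => isSupercompactObject_iff.2
    (h.2 (isSupercompactObject_iff.1 hB) (isSupercompactObject_iff.1 hB) hK)⟩

variable [IsGrothendieckTopos E]

/-- An object covered by a `κ`-indexed family of compact objects is compact. -/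
lemma isCompactFor_of_cover (hκ : IsIndexClass κ) {A : E} {T : Type} (hT : κ T) {X : T → E}
    {f : ∀ t, X t ⟶ A} (hf : IsCoveringFamily X f) (hX : ∀ t, IsCompactFor κ (X t)) :
    IsCompactFor κ A := by
  intro ι Y g hg
  have h (t : T) : IsCoveringFamily (fun i => pullback (g i) (f t))
      (fun i => pullback.snd (g i) (f t)) := by
    refine isCoveringFamily_of_mem
      ((epiTopology E).pullback_stable (f t) (isCoveringFamily_iff.1 hg)) ?_
    rintro W k ⟨_, a, _, ⟨i⟩, h⟩
    exact ⟨i, pullback.lift a k h, pullback.lift_snd ..⟩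
  choose S σ hS hσ using fun t => hX t _ _ (h t)
  refine ⟨Σ t, S t, fun p => σ p.1 p.2, hκ.sigma hT hS, fun Z a b H => hf a b fun t =>
    hσ t _ _ fun s => ?_⟩
  rw [← Category.assoc, ← Category.assoc, ← pullback.condition, Category.assoc, Category.assoc,
    H ⟨t, s⟩]

lemma IsCompactFor.of_iso (hκ : IsIndexClass κ) {A B : E} (i : A ≅ B) (hA : IsCompactFor κ A) :
    IsCompactFor κ B :=
  isCompactFor_of_cover hκ hκ.unit (X := fun _ => A) (f := fun _ => i.hom)
    (fun _ _ _ H => (cancel_epi i.hom).1 (H ⟨⟩)) fun _ => hA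

lemma isClosedUnderIsomorphisms_isCoherentFor (hκ : IsIndexClass κ) :
    ObjectProperty.IsClosedUnderIsomorphisms (IsCoherentFor κ : ObjectProperty E) where
  of_iso {A B} i hA := ⟨hA.1.of_iso hκ i, fun X Y K x y p q hX hY sq =>
    hA.2 (x := x ≫ i.inv) (y := y ≫ i.inv) (p := p) (q := q) hX hY
      (IsPullback.of_iso sq (Iso.refl _) (Iso.refl _) (Iso.refl _) i.symm (by simp) (by simp)
        (by simp) (by simp))⟩

end Compact

section Site

variable {E : Type u} [Category.{v} E] {κ : Type → Prop} {C : Type v} [SmallCategory C]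

/-- Every covering sieve contains a family of arrows indexed by a type in `κ` which generates a
covering sieve. -/
def HasCoversIn (κ : Type → Prop) {C : Type u} [Category.{v} C] (J : GrothendieckTopology C) :
    Prop :=
  ∀ ⦃c : C⦄ (S : Sieve c), S ∈ J c → ∃ (T : Type) (X : T → C) (f : ∀ t, X t ⟶ c),
    κ T ∧ (∀ t, S (f t)) ∧ Sieve.generate (Presieve.ofArrows X f) ∈ J c

variable {J : GrothendieckTopology C} (e : E ≌ Sheaf J (Type v))

/-- A compact object over a generator is covered by `κ` many generators which lie over it by
arrows of the site. -/
lemma exists_cover_by_generators {c : C} {X : E} (hX : IsCompactFor κ X)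
    (f : X ⟶ (generator e).obj c) :
    ∃ (T : Type) (d : T → C) (g : ∀ t, d t ⟶ c) (x : ∀ t, (generator e).obj (d t) ⟶ X), κ T ∧
      IsCoveringFamily _ x ∧ ∀ t, x t ≫ f = (generator e).map (g t) := by
  let ι : Type v := Σ d : C, {p : ((generator e).obj d ⟶ X) × (d ⟶ c) //
    p.1 ≫ f = (generator e).map p.2}
  have h : IsCoveringFamily (fun i : ι => (generator e).obj i.1) (fun i : ι => i.2.1.1) := by
    intro Z a b H
    refine generator_hom_ext e fun d y => hom_ext_of_cover e
      (imageSieve_generator_mem e (y ≫ f)) fun d' k hk => ?_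
    obtain ⟨l, hl⟩ := hk
    simpa using H ⟨d', ((generator e).map k ≫ y, l), by simp [hl]⟩
  obtain ⟨T, σ, hT, hσ⟩ := hX _ _ h
  exact ⟨T, fun t => (σ t).1, fun t => (σ t).2.1.2, fun t => (σ t).2.1.1, hT, hσ,
    fun t => (σ t).2.2⟩

variable [IsGrothendieckTopos E]

lemma isCoveringFamily_generator_map {c : C} {ι : Type*} {X : ι → C} {f : ∀ i, X i ⟶ c}
    (h : Sieve.generate (Presieve.ofArrows X f) ∈ J c) :
    IsCoveringFamily (fun i => (generator e).obj (X i)) (fun i => (generator e).map (f i)) := by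
  refine isCoveringFamily_of_mem (S := Sieve.functorPushforward (generator e) _)
    ((functorPushforward_generator_jointlyEpi_iff e).2 h) ?_
  rintro W _ ⟨d, _, a, ⟨_, b, _, ⟨i⟩, rfl⟩, rfl⟩
  exact ⟨i, a ≫ (generator e).map b, by simp⟩

lemma isCompactFor_generator (hJ : HasCoversIn κ J) (c : C) :
    IsCompactFor κ ((generator e).obj c) := by
  intro ι X f hf
  obtain ⟨T, Y, g, hT, hg, hcov⟩ := hJ _
    (JointlyEpi.mem_of_section e (isCoveringFamily_iff_jointlyEpi.1 hf) (𝟙 _))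
  have (t : T) : ∃ i, ∃ a, a ≫ f i = (generator e).map (g t) := by
    obtain ⟨_, a, _, ⟨i⟩, h⟩ := hg t
    exact ⟨i, a, by simpa using h⟩
  choose σ a ha using this
  refine ⟨T, σ, hT, fun Z u w H => isCoveringFamily_generator_map e hcov u w fun t => ?_⟩
  change (generator e).map (g t) ≫ u = (generator e).map (g t) ≫ w
  rw [← ha, Category.assoc, Category.assoc, H]

variable [HasFiniteLimits C]

instance : PreservesFiniteLimits (generator e) := by
  unfold generator
  infer_instance

/-- If `X` and `Y` are covered by generators over `c` by arrows of the site, then `X ×[c] Y` is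
covered by the pullbacks of these generators, which are again generators. -/
lemma isCoherentFor_generator (hκ : IsIndexClass κ) (hJ : HasCoversIn κ J) (c : C) :
    IsCoherentFor κ ((generator e).obj c) := by
  refine ⟨isCompactFor_generator e hJ c, fun X Y K x y p q hX hY sq => ?_⟩
  obtain ⟨T, d, g, a, hT, ha, hg⟩ := exists_cover_by_generators e hX x
  obtain ⟨T', d', g', a', hT', ha', hg'⟩ := exists_cover_by_generators e hY y
  have sq' (i : Σ _ : T, T') :=
    (IsPullback.of_hasPullback (g i.1) (g' i.2)).map (generator e)
  have w (i : Σ _ : T, T') :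
      ((generator e).map (pullback.fst (g i.1) (g' i.2)) ≫ a i.1) ≫ x =
      ((generator e).map (pullback.snd (g i.1) (g' i.2)) ≫ a' i.2) ≫ y := by
    rw [Category.assoc, Category.assoc, hg, hg', (sq' i).w]
  refine isCompactFor_of_cover hκ (hκ.sigma hT fun _ => hT')
    (f := fun i => sq.lift _ _ (w i)) ?_ fun i => isCompactFor_generator e hJ _
  refine isCoveringFamily_of_mem ((epiTopology E).intersection_covering
    ((epiTopology E).pullback_stable p (isCoveringFamily_iff.1 ha))
    ((epiTopology E).pullback_stable q (isCoveringFamily_iff.1 ha'))) ?_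
  rintro W k ⟨⟨_, b, _, ⟨t⟩, hb⟩, ⟨_, b', _, ⟨t'⟩, hb'⟩⟩
  refine ⟨⟨t, t'⟩, (sq' ⟨t, t'⟩).lift b b' ?_, ?_⟩
  · rw [← hg, ← hg', reassoc_of% hb, reassoc_of% hb', sq.w]
  · apply sq.hom_ext
    · rw [Category.assoc, sq.lift_fst, IsPullback.lift_fst_assoc, hb]
    · rw [Category.assoc, sq.lift_snd, IsPullback.lift_snd_assoc, hb']

/-- The equalizer of two arrows from a generator to a coherent object is compact: it is the
pullback of the compact object `pullback f g` along the diagonal of the generator. -/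
lemma isCompactFor_equalizer (hκ : IsIndexClass κ) (hJ : HasCoversIn κ J) {d : C} {B : E}
    (hB : IsCoherentFor κ B) (f g : (generator e).obj d ⟶ B) :
    IsCompactFor κ (equalizer f g) := by
  have hd := isCompactFor_generator e hJ d
  have hW : IsCompactFor κ (pullback f g) := hB.2 hd hd (IsPullback.of_hasPullback f g)
  have sq := (IsPullback.of_hasPullback (terminal.from d) (terminal.from d)).map (generator e)
  let δ := (generator e).map (pullback.lift (f := terminal.from d) (g := terminal.from d)
    (𝟙 d) (𝟙 d) rfl)
  have hδ₁ : δ ≫ (generator e).map (pullback.fst _ _) = 𝟙 _ := by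
    rw [← Functor.map_comp, pullback.lift_fst, CategoryTheory.Functor.map_id]
  have hδ₂ : δ ≫ (generator e).map (pullback.snd _ _) = 𝟙 _ := by
    rw [← Functor.map_comp, pullback.lift_snd, CategoryTheory.Functor.map_id]
  let π := sq.lift (pullback.fst f g) (pullback.snd f g)
    ((terminalIsTerminal.isTerminalObj (generator e)).hom_ext _ _)
  have hQ : IsCompactFor κ (pullback δ π) :=
    (isCoherentFor_generator e hκ hJ _).2 hd hW (IsPullback.of_hasPullback δ π)
  have h₁ : pullback.fst δ π = pullback.snd δ π ≫ pullback.fst f g := by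
    have := pullback.condition (f := δ) (g := π) =≫ (generator e).map (pullback.fst _ _)
    rwa [Category.assoc, Category.assoc, hδ₁, sq.lift_fst, Category.comp_id] at this
  have h₂ : pullback.fst δ π = pullback.snd δ π ≫ pullback.snd f g := by
    have := pullback.condition (f := δ) (g := π) =≫ (generator e).map (pullback.snd _ _)
    rwa [Category.assoc, Category.assoc, hδ₂, sq.lift_snd, Category.comp_id] at this
  let l : pullback δ π ⟶ equalizer f g := equalizer.lift (pullback.fst δ π) (by
    rw [h₁, Category.assoc, pullback.condition, ← Category.assoc, ← h₂, ← h₁])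
  let r : equalizer f g ⟶ pullback δ π := pullback.lift (equalizer.ι f g)
    (pullback.lift (equalizer.ι f g) (equalizer.ι f g) (equalizer.condition f g)) (by
      apply sq.hom_ext
      · rw [Category.assoc, Category.assoc, hδ₁, sq.lift_fst, pullback.lift_fst,
          Category.comp_id]
      · rw [Category.assoc, Category.assoc, hδ₂, sq.lift_snd, pullback.lift_snd,
          Category.comp_id])
  have hrl : r ≫ l = 𝟙 _ := by
    apply equalizer.hom_ext
    rw [Category.assoc, equalizer.lift_ι, pullback.lift_fst, Category.id_comp]
  refine isCompactFor_of_cover hκ hκ.unit (X := fun _ => pullback δ π) (f := fun _ => l) ?_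
    fun _ => hQ
  intro Z a b H
  rw [← Category.id_comp a, ← Category.id_comp b, ← hrl, Category.assoc, Category.assoc, H ⟨⟩]

/-- Coherent objects are closed under pullbacks. -/
lemma IsCoherentFor.of_isPullback (e : E ≌ Sheaf J (Type v)) (hκ : IsIndexClass κ)
    (hJ : HasCoversIn κ J) {A B B' P : E}
    {b : B ⟶ A} {b' : B' ⟶ A} {p : P ⟶ B} {q : P ⟶ B'} (sq : IsPullback p q b b')
    (hA : IsCoherentFor κ A) (hB : IsCoherentFor κ B) (hB' : IsCoherentFor κ B') :
    IsCoherentFor κ P := by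
  refine ⟨hA.2 hB.1 hB'.1 sq, fun X Y Z x y r s hX hY sq' => ?_⟩
  -- `Z` is the equalizer of the two arrows from `X ×[B] Y` to `B'`.
  have hW : IsCompactFor κ (pullback (x ≫ p) (y ≫ p)) :=
    hB.2 hX hY (IsPullback.of_hasPullback _ _)
  obtain ⟨T, d, -, w, hT, hw, -⟩ := exists_cover_by_generators e hW
    ((terminalIsTerminal.isTerminalObj (generator e)).from _)
  let u (t : T) : (generator e).obj (d t) ⟶ X := w t ≫ pullback.fst _ _
  let u' (t : T) : (generator e).obj (d t) ⟶ Y := w t ≫ pullback.snd _ _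
  have huu' (t : T) : u t ≫ x ≫ p = u' t ≫ y ≫ p := by
    simp only [u, u', Category.assoc, pullback.condition]
  let j (t : T) : equalizer (u t ≫ x ≫ q) (u' t ≫ y ≫ q) ⟶ Z :=
    sq'.lift (equalizer.ι _ _ ≫ u t) (equalizer.ι _ _ ≫ u' t) (by
      apply sq.hom_ext
      · simp only [Category.assoc, huu']
      · simpa only [Category.assoc] using equalizer.condition (u t ≫ x ≫ q) (u' t ≫ y ≫ q))
  refine isCompactFor_of_cover hκ hT (f := j) ?_ fun t => isCompactFor_equalizer e hκ hJ hB' _ _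
  have hrs : r ≫ x ≫ p = s ≫ y ≫ p := by rw [reassoc_of% sq'.w]
  refine isCoveringFamily_of_mem ((epiTopology E).pullback_stable (pullback.lift r s hrs)
    (isCoveringFamily_iff.1 hw)) ?_
  rintro V k ⟨_, a, _, ⟨t⟩, ha⟩
  have h₁ : a ≫ u t = k ≫ r := by
    simp only [u, reassoc_of% ha, pullback.lift_fst]
  have h₂ : a ≫ u' t = k ≫ s := by
    simp only [u', reassoc_of% ha, pullback.lift_snd]
  refine ⟨t, equalizer.lift a ?_, ?_⟩
  · rw [reassoc_of% h₁, reassoc_of% h₂, reassoc_of% sq'.w]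
  · apply sq'.hom_ext
    · rw [Category.assoc, sq'.lift_fst, equalizer.lift_ι_assoc, h₁]
    · rw [Category.assoc, sq'.lift_snd, equalizer.lift_ι_assoc, h₂]

end Site

/-! ### Closure under finite limits -/

/-- A property of objects which is closed under isomorphisms and pullbacks and holds for a
terminal object is closed under finite limits. -/
lemma isClosedUnderLimitsOfShape_of_pullbacks {E : Type u} [Category.{v} E] [HasFiniteLimits E]
    (R : ObjectProperty E) [R.IsClosedUnderIsomorphisms]
    [R.IsClosedUnderLimitsOfShape WalkingCospan] {T : E} (hT : IsTerminal T) (hRT : R T)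
    (K : Type) [SmallCategory K] [FinCategory K] : R.IsClosedUnderLimitsOfShape K := by
  have : R.IsClosedUnderLimitsOfShape (Discrete.{0} PEmpty) := ⟨by
    rintro X ⟨h⟩
    refine R.prop_of_iso (IsTerminal.uniqueUpToIso hT ?_) hRT
    exact IsLimit.equivOfNatIsoOfIso (Functor.emptyExt h.diag (Functor.empty E)) _ (asEmptyCone X)
      (Cone.ext (Iso.refl _) (by rintro ⟨⟨⟩⟩)) h.isLimit⟩
  have : HasPullbacks R.FullSubcategory := hasLimitsOfShape_of_closedUnderLimits _ _
  have : HasTerminal R.FullSubcategory := hasLimitsOfShape_of_closedUnderLimits _ _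
  have : HasFiniteLimits R.FullSubcategory := hasFiniteLimits_of_hasTerminal_and_pullbacks
  have : PreservesFiniteLimits R.ι := preservesFiniteLimits_of_preservesTerminal_and_pullbacks _
  exact R.isClosedUnderLimitsOfShape_of_preservesLimitsOfShape_ι K

section

variable {E : Type u} [Category.{v} E] [IsGrothendieckTopos E] {κ : Type → Prop}

/-- If the covers of a site with finite limits are generated by families indexed by types in `κ`,
then its topos has a separating set of coherent objects closed under finite limits: close the
generators under pullbacks. -/
theorem exists_isSeparatingSet_isCoherentFor (hκ : IsIndexClass κ) {C : Type v} [SmallCategory C]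
    [HasFiniteLimits C] {J : GrothendieckTopology C} (hJ : HasCoversIn κ J)
    (e : E ≌ Sheaf J (Type v)) :
    ∃ P : ObjectProperty E, IsSeparatingSet P ∧ (∀ A, P A → IsCoherentFor κ A) ∧
      IsClosedUnderFiniteLimits P := by
  let R := (ObjectProperty.ofObj (generator e).obj).limitClosure WalkingCospan
  have hR : R ≤ IsCoherentFor κ := by
    have := isClosedUnderIsomorphisms_isCoherentFor (E := E) hκ
    have : ObjectProperty.IsClosedUnderLimitsOfShape (IsCoherentFor κ : ObjectProperty E)
        WalkingCospan := .mk' (by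
      rintro _ ⟨F, hF⟩
      exact IsCoherentFor.of_isPullback e hκ hJ (IsPullback.of_isLimit_cone (limit.isLimit F))
        (hF _) (hF _) (hF _))
    refine ObjectProperty.limitsClosure_le ?_
    rintro _ ⟨c⟩
    exact isCoherentFor_generator e hκ hJ c
  obtain ⟨P, hP, hPR, hRP⟩ := ObjectProperty.EssentiallySmall.exists_small_le.{v} R
  have hgen : ObjectProperty.ofObj (generator e).obj ≤ R := ObjectProperty.le_limitsClosure _ _
  refine ⟨P, ⟨hP, fun X Y f g H => ?_⟩, fun A hA => hR _ (hPR _ hA), fun K _ _ F c hF hc => ?_⟩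
  · refine generator_isSeparating e f g ?_
    intro G hG a
    obtain ⟨G', hG', ⟨i⟩⟩ := hRP _ (hgen _ hG)
    rw [← cancel_epi i.inv, ← Category.assoc, ← Category.assoc, H G' hG']
  · have := isClosedUnderLimitsOfShape_of_pullbacks R
      (terminalIsTerminal.isTerminalObj (generator e)) (hgen _ ⟨⊤_ C⟩) K
    obtain ⟨Y, hY, i⟩ := hRP _ (R.prop_of_isLimit hc fun k => hPR _ (hF k))
    exact ⟨Y, hY, i⟩

/-- A separating set of compact objects which is closed under finite limits is, with the topology
induced by the topos, a site of definition whose covers are generated by families indexed by types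
in `κ`. -/
theorem exists_site_of_isSeparatingSet {P : ObjectProperty E} (hP : IsSeparatingSet P)
    (hκ : ∀ A, P A → IsCompactFor κ A) (hlim : IsClosedUnderFiniteLimits P) :
    ∃ (C : Type v) (_ : SmallCategory C) (J : GrothendieckTopology C),
      HasFiniteLimits C ∧ HasCoversIn κ J ∧ Nonempty (E ≌ Sheaf J (Type v)) := by
  obtain ⟨I, o, rfl⟩ := hP.exists_family
  have := isCoverDense_inducedFunctor hP.2
  refine ⟨InducedCategory E o, inferInstance,
    (inducedFunctor o).inducedTopology (epiTopology E), ⟨fun K _ _ => ⟨fun F => ?_⟩⟩, ?_,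
    nonempty_equivalence_sheaf⟩
  · obtain ⟨_, ⟨i⟩, ⟨φ⟩⟩ := hlim K (F ⋙ inducedFunctor o) _ (fun k => ⟨F.obj k⟩)
      (limit.isLimit (F ⋙ inducedFunctor o))
    have : CreatesLimit F (inducedFunctor o) := createsLimitOfFullyFaithfulOfIso i φ.symm
    exact hasLimit_of_created F (inducedFunctor o)
  · intro c S hS
    let ι : Type v := Σ d : InducedCategory E o, {f : d ⟶ c // S f}
    have hι : IsCoveringFamily (fun i : ι => o i.1) (fun i : ι => i.2.1.hom) := by
      refine isCoveringFamily_of_mem (S := S.functorPushforward (inducedFunctor o))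
        ((Functor.mem_inducedTopology_iff_of_isCoverDense ..).1 hS) ?_
      rintro W _ ⟨d, f, a, hf, rfl⟩
      exact ⟨⟨d, f, hf⟩, a, rfl⟩
    obtain ⟨T, σ, hT, hσ⟩ := hκ (o c) ⟨c⟩ _ _ hι
    refine ⟨T, fun t => (σ t).1, fun t => (σ t).2.1, hT, fun t => (σ t).2.2, ?_⟩
    refine (Functor.mem_inducedTopology_iff_of_isCoverDense ..).2 ?_
    refine (epiTopology E).superset_covering ?_ (isCoveringFamily_iff.1 hσ)
    rintro W _ ⟨_, a, _, ⟨t⟩, rfl⟩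
    exact ⟨_, _, a, Sieve.ofArrows_mk _ _ t, rfl⟩

end

/-! ### Coherent and regular toposes -/

section

variable {C : Type u} [Category.{v} C] {J : GrothendieckTopology C}

lemma isCoherentSite_iff : IsCoherentSite J ↔
    HasFiniteLimits C ∧ HasCoversIn (fun T => Finite T) J := by
  refine ⟨fun h => ⟨h.1, fun c S hS => ?_⟩, fun h => ⟨h.1, fun c S hS => ?_⟩⟩
  · obtain ⟨n, X, f, hf, hc⟩ := h.2 S hS
    exact ⟨Fin n, X, f, inferInstance, hf, hc⟩
  · obtain ⟨T, X, f, hT, hf, hc⟩ := h.2 S hS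
    obtain ⟨n, ⟨φ⟩⟩ := Finite.exists_equiv_fin T
    refine ⟨n, fun i => X (φ.symm i), fun i => f (φ.symm i), fun i => hf _,
      J.superset_covering ?_ hc⟩
    rintro W _ ⟨_, a, _, ⟨t⟩, rfl⟩
    obtain ⟨i, rfl⟩ := φ.symm.surjective t
    exact ⟨_, a, _, ⟨i⟩, rfl⟩

lemma isRegularSite_iff : IsRegularSite J ↔
    HasFiniteLimits C ∧ HasCoversIn (fun T => Nonempty (Unique T)) J := by
  refine ⟨fun h => ⟨h.1, fun c S hS => ?_⟩, fun h => ⟨h.1, fun c S hS => ?_⟩⟩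
  · obtain ⟨d, f, hf, hc⟩ := h.2 S hS
    refine ⟨PUnit, fun _ => d, fun _ => f, ⟨inferInstance⟩, fun _ => hf, ?_⟩
    rwa [Presieve.ofArrows_pUnit]
  · obtain ⟨T, X, f, ⟨hT⟩, hf, hc⟩ := h.2 S hS
    refine ⟨X default, f default, hf _, J.superset_covering ?_ hc⟩
    rintro W _ ⟨_, a, _, ⟨t⟩, rfl⟩
    obtain rfl := Subsingleton.elim t default
    exact ⟨_, a, _, ⟨⟩, rfl⟩

end

section

variable {E : Type u} [Category.{v} E] [IsGrothendieckTopos E]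

theorem isCoherentTopos_iff : IsCoherentTopos E ↔
    ∃ P : ObjectProperty E, IsSeparatingSet P ∧ (∀ A, P A → IsCoherentObject A) ∧
      IsClosedUnderFiniteLimits P := by
  constructor
  · rintro ⟨C, _, J, hJ, ⟨e⟩⟩
    obtain ⟨_, hJ⟩ := isCoherentSite_iff.1 hJ
    obtain ⟨P, hP, h, hlim⟩ := exists_isSeparatingSet_isCoherentFor isIndexClass_finite hJ e
    exact ⟨P, hP, fun A hA => (h A hA).isCoherentObject, hlim⟩
  · rintro ⟨P, hP, h, hlim⟩
    obtain ⟨C, _, J, hC, hJ, he⟩ := exists_site_of_isSeparatingSet hP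
      (fun A hA => isCompactObject_iff.1 (h A hA).1) hlim
    exact ⟨C, _, J, isCoherentSite_iff.2 ⟨hC, hJ⟩, he⟩

theorem isRegularTopos_iff : IsRegularTopos E ↔
    ∃ P : ObjectProperty E, IsSeparatingSet P ∧ (∀ A, P A → IsRegularObject A) ∧
      IsClosedUnderFiniteLimits P := by
  constructor
  · rintro ⟨C, _, J, hJ, ⟨e⟩⟩
    obtain ⟨_, hJ⟩ := isRegularSite_iff.1 hJ
    obtain ⟨P, hP, h, hlim⟩ := exists_isSeparatingSet_isCoherentFor isIndexClass_unique hJ e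
    exact ⟨P, hP, fun A hA => (h A hA).isRegularObject, hlim⟩
  · rintro ⟨P, hP, h, hlim⟩
    obtain ⟨C, _, J, hC, hJ, he⟩ := exists_site_of_isSeparatingSet hP
      (fun A hA => isSupercompactObject_iff.1 (h A hA).1) hlim
    exact ⟨C, _, J, isRegularSite_iff.2 ⟨hC, hJ⟩, he⟩

end

end ToposTheory

theorem theorem2p7 {E : Type u} [Category.{v} E] [ToposTheory.IsGrothendieckTopos E] :
    (ToposTheory.IsLocallyConnectedTopos E ↔
      ∃ P : ObjectProperty E, ToposTheory.IsSeparatingSet P ∧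
        ∀ A, P A → ToposTheory.IsIndecomposableObject A) ∧
    ((ToposTheory.IsConnectedTopos E ∧ ToposTheory.IsLocallyConnectedTopos E) ↔
      ∃ P : ObjectProperty E, ToposTheory.IsSeparatingSet P ∧
        (∀ A, P A → ToposTheory.IsIndecomposableObject A) ∧ ToposTheory.ContainsTerminal P) ∧
    (ToposTheory.IsAtomicTopos E ↔
      ∃ P : ObjectProperty E, ToposTheory.IsSeparatingSet P ∧
        ∀ A, P A → ToposTheory.IsAtomObject A) ∧
    (ToposTheory.IsCoherentTopos E ↔
      ∃ P : ObjectProperty E, ToposTheory.IsSeparatingSet P ∧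
        (∀ A, P A → ToposTheory.IsCoherentObject A) ∧
        ToposTheory.IsClosedUnderFiniteLimits P) ∧
    (ToposTheory.IsRegularTopos E ↔
      ∃ P : ObjectProperty E, ToposTheory.IsSeparatingSet P ∧
        (∀ A, P A → ToposTheory.IsRegularObject A) ∧
        ToposTheory.IsClosedUnderFiniteLimits P) :=
  ⟨ToposTheory.isLocallyConnectedTopos_iff,
    ToposTheory.isConnectedTopos_and_isLocallyConnectedTopos_iff,
    ToposTheory.isAtomicTopos_iff, ToposTheory.isCoherentTopos_iff,
    ToposTheory.isRegularTopos_iff⟩
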